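/- Let $S$ be an integral domain, let $0<d<r$ be integers, and let $\Omega=(\omega_a)_{a\ge 0}$ be a sequence in $S$. Degenerate case: let $u_1,\dots,u_r\in S$, and for $k\ge 1$ and $v_1,\dots,v_k\in S$ let $A_{2,S,k}(v_1,\dots,v_k)$ be the degenerate cyclotomic BMW algebra on two strands, i.e. the unital associative $S$-algebra generated by $s_1,e_1,y_1,y_2$ with relations $s_1^2=1$; $e_1^2=\omega_0e_1$; $e_1y_1^ae_1=\omega_ae_1$ for $a>0$; $y_1y_2=y_2y_1$; $e_1s_1=e_1=s_1e_1$; $s_1y_1-y_2s_1=e_1-1=y_1s_1-s_1y_2$; $e_1(y_1+y_2)=0=(y_1+y_2)e_1$; and $(y_1-v_1)\cdots(y_1-v_k)=0$. Non-degenerate case: let $\rho,q,u_1,\dots,u_r\in S$ be invertible with $\rho^{-1}-\rho=(q^{-1}-q)(\omega_0-1)$, and for $k\ge 1$ and invertible $v_1,\dots,v_k\in S$ let $A_{2,S,k}(v_1,\dots,v_k)$ be the cyclotomic BMW algebra on two strands, i.e. the unital associative $S$-algebra generated by $y_1^{\pm1},g_1^{\pm1},e_1$ with relations (besides those making $y_1^{-1}$,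 $g_1^{-1}$ the inverses of $y_1$, $g_1$) $y_1g_1y_1g_1=g_1y_1g_1y_1$; $e_1^2=\omega_0e_1$; $e_1y_1^je_1=\omega_je_1$ for $j\ge1$; $g_1e_1=e_1g_1=\rho^{-1}e_1$; $g_1-g_1^{-1}=(q-q^{-1})(1-e_1)$; $e_1y_1g_1y_1g_1=e_1=g_1y_1g_1y_1e_1$; and $(y_1-v_1)\cdots(y_1-v_k)=0$. In either case, assume that the parameters are $d$-semi-admissible, that is, in $A_{2,S,r}(u_1,\dots,u_r)$ the family $(e_1,y_1e_1,\dots,y_1^{d-1}e_1)$ is linearly independent over $S$ but $(e_1,y_1e_1,\dots,y_1^{d}e_1)$ is linearly dependent. Put $p_0(u)=(u-u_1)\cdots(u-u_d)=\sum_{j=0}^d b_ju^j\in S[u]$ and assume that $p_0(y_1)e_1=0$ in $A_{2,S,r}(u_1,\dots,u_r)$. Then: 1. $\sum_{j=0}^d b_j\,\omega_{j+\ell}=0$ for all $\ell\ge 0$. 2. The parameters $\Omega,u_1,\dots,u_d$ (respectively $\rho,q,\Omega,u_1,\dots,u_d$ in the non-degenerate case) are admissible: the family $(e_1,y_1e_1,\dots,y_1^{d-1}e_1)$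 is linearly independent over $S$ in $A_{2,S,d}(u_1,\dots,u_d)$. -/

import Mathlib

open Polynomial

namespace BMW

/-- The polynomial `(u - u_1) ⋯ (u - u_k)`. -/
noncomputable def rootPoly {S : Type*} [CommRing S] {k : ℕ} (u : Fin k → S) : S[X] :=
  ∏ i, (X - C (u i))

/-- The indices `i`, `j` differ by at least two. -/
def Far {m : ℕ} (i j : Fin m) : Prop := (i : ℕ) + 1 < j ∨ (j : ℕ) + 1 < i

/-- The indices `i`, `j` differ by exactly one. -/
def Adjacent {m : ℕ} (i j : Fin m) : Prop := (i : ℕ) + 1 = j ∨ (j : ℕ) + 1 = i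

/-- The relation imposing the single equation `p(y) = 0`. -/
inductive PolyRel {S A : Type*} [CommRing S] [Ring A] [Algebra S A] (p : S[X]) (y : A) :
    A → A → Prop
  | rel : PolyRel p y (aeval y p) 0

/-- `(e, y e, …, y^(k-1) e)` is linearly independent over `S`. -/
def PowersIndependent (S : Type*) {A : Type*} [CommRing S] [Ring A] [Algebra S A]
    (y e : A) (k : ℕ) : Prop :=
  LinearIndependent S (fun i : Fin k => y ^ (i : ℕ) * e)

/-! ### Degenerate affine and cyclotomic BMW algebras

All indices are shifted by one with respect to the usual `1`-based ones. The parameter `m` is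
`n - 1`, where `n = m + 1` is the number of strands. Thus `s`, `e` are indexed by `Fin m`, `y` is
indexed by `Fin (m + 1)`, and for `i : Fin m` the elements usually written `y_i`, `y_{i+1}` are
`y i.castSucc`, `y i.succ`. -/

/-- Generators of the degenerate affine BMW algebra on `m + 1` strands. -/
inductive DegGen (m : ℕ) : Type
  | s (i : Fin m)
  | e (i : Fin m)
  | y (j : Fin (m + 1))

section Degenerate

variable {S : Type*} [CommRing S]

/-- The free generators `s_i`, `e_i`, `y_j`. -/
def ds {m : ℕ} (i : Fin m) : FreeAlgebra S (DegGen m) := FreeAlgebra.ι S (DegGen.s i)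

def de {m : ℕ} (i : Fin m) : FreeAlgebra S (DegGen m) := FreeAlgebra.ι S (DegGen.e i)

def dy {m : ℕ} (j : Fin (m + 1)) : FreeAlgebra S (DegGen m) := FreeAlgebra.ι S (DegGen.y j)

/-- Defining relations of the degenerate affine BMW algebra on `m + 1` strands. -/
inductive DegRel (m : ℕ) (ω : ℕ → S) :
    FreeAlgebra S (DegGen m) → FreeAlgebra S (DegGen m) → Prop
  | involution (i : Fin m) : DegRel m ω (ds i * ds i) 1
  | s_s_far (i j : Fin m) (h : Far i j) : DegRel m ω (ds i * ds j) (ds j * ds i)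
  | braid (i j : Fin m) (h : (j : ℕ) = i + 1) :
      DegRel m ω (ds i * ds j * ds i) (ds j * ds i * ds j)
  | s_y (i : Fin m) (j : Fin (m + 1)) (h : j ≠ i.castSucc) (h' : j ≠ i.succ) :
      DegRel m ω (ds i * dy j) (dy j * ds i)
  | idempotent (i : Fin m) : DegRel m ω (de i * de i) (ω 0 • de i)
  | compression (i : Fin m) (hi : (i : ℕ) = 0) (a : ℕ) (ha : 0 < a) :
      DegRel m ω (de i * dy 0 ^ a * de i) (ω a • de i)
  | s_e_far (i j : Fin m) (h : Far i j) : DegRel m ω (ds i * de j) (de j * ds i)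
  | e_e_far (i j : Fin m) (h : Far i j) : DegRel m ω (de i * de j) (de j * de i)
  | e_y (i : Fin m) (j : Fin (m + 1)) (h : j ≠ i.castSucc) (h' : j ≠ i.succ) :
      DegRel m ω (de i * dy j) (dy j * de i)
  | y_y (i j : Fin (m + 1)) : DegRel m ω (dy i * dy j) (dy j * dy i)
  | e_s (i : Fin m) : DegRel m ω (de i * ds i) (de i)
  | s_e (i : Fin m) : DegRel m ω (ds i * de i) (de i)
  | tangle₁ (i j : Fin m) (h : (j : ℕ) = i + 1) :
      DegRel m ω (ds i * de j * de i) (ds j * de i)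
  | tangle₂ (i j : Fin m) (h : (j : ℕ) = i + 1) :
      DegRel m ω (de i * de j * ds i) (de i * ds j)
  | tangle₃ (i j : Fin m) (h : (j : ℕ) = i + 1) :
      DegRel m ω (de j * de i * ds j) (de j * ds i)
  | tangle₄ (i j : Fin m) (h : (j : ℕ) = i + 1) :
      DegRel m ω (ds j * de i * de j) (ds i * de j)
  | tangle₅ (i j : Fin m) (h : (j : ℕ) = i + 1) :
      DegRel m ω (de j * de i * de j) (de j)
  | tangle₆ (i j : Fin m) (h : (j : ℕ) = i + 1) :
      DegRel m ω (de i * de j * de i) (de i)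
  | skein₁ (i : Fin m) :
      DegRel m ω (ds i * dy i.castSucc - dy i.succ * ds i) (de i - 1)
  | skein₂ (i : Fin m) :
      DegRel m ω (dy i.castSucc * ds i - ds i * dy i.succ) (de i - 1)
  | antisymm₁ (i : Fin m) : DegRel m ω (de i * (dy i.castSucc + dy i.succ)) 0
  | antisymm₂ (i : Fin m) : DegRel m ω ((dy i.castSucc + dy i.succ) * de i) 0

/-- The degenerate affine BMW algebra on `m + 1` strands. -/
abbrev DegAffine (m : ℕ) (ω : ℕ → S) : Type _ := RingQuot (DegRel m ω)

/-- The image of a generator in the degenerate affine BMW algebra. -/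
noncomputable def DegAffine.gen {m : ℕ} (ω : ℕ → S) (x : DegGen m) : DegAffine m ω :=
  RingQuot.mkAlgHom S (DegRel m ω) (FreeAlgebra.ι S x)

/-- The degenerate cyclotomic BMW algebra on `m + 1` strands: the quotient of the degenerate affine
algebra by the relation `(y_1 - u_1) ⋯ (y_1 - u_r) = 0`. -/
abbrev DegCyclotomic (m : ℕ) (ω : ℕ → S) {r : ℕ} (u : Fin r → S) : Type _ :=
  RingQuot (PolyRel (rootPoly u) (DegAffine.gen ω (DegGen.y (0 : Fin (m + 1)))))

/-- The image of a generator in the degenerate cyclotomic BMW algebra. -/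
noncomputable def DegCyclotomic.gen {m : ℕ} (ω : ℕ → S) {r : ℕ} (u : Fin r → S) (x : DegGen m) :
    DegCyclotomic m ω u :=
  RingQuot.mkAlgHom S (PolyRel (rootPoly u) (DegAffine.gen ω (DegGen.y (0 : Fin (m + 1)))))
    (DegAffine.gen ω x)

/-- The element `y_1` of the degenerate cyclotomic BMW algebra on two strands. -/
noncomputable def degY₁ (ω : ℕ → S) {r : ℕ} (u : Fin r → S) : DegCyclotomic 1 ω u :=
  DegCyclotomic.gen ω u (DegGen.y 0)

/-- The element `e_1` of the degenerate cyclotomic BMW algebra on two strands. -/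
noncomputable def degE₁ (ω : ℕ → S) {r : ℕ} (u : Fin r → S) : DegCyclotomic 1 ω u :=
  DegCyclotomic.gen ω u (DegGen.e 0)

/-- Admissibility of the parameters in the degenerate case. -/
def DegAdmissible (ω : ℕ → S) {r : ℕ} (u : Fin r → S) : Prop :=
  PowersIndependent S (degY₁ ω u) (degE₁ ω u) r

/-- `d`-semi-admissibility of the parameters in the degenerate case (for `0 < d < r`). -/
def DegSemiAdmissible (ω : ℕ → S) {r : ℕ} (u : Fin r → S) (d : ℕ) : Prop :=
  PowersIndependent S (degY₁ ω u) (degE₁ ω u) d ∧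
    ¬ PowersIndependent S (degY₁ ω u) (degE₁ ω u) (d + 1)

end Degenerate

/-! ### Affine and cyclotomic BMW algebras

Again `m + 1` is the number of strands and all indices are `0`-based. -/

/-- Generators of the affine BMW algebra on `m + 1` strands; `y` is the element `y_1`. -/
inductive AffGen (m : ℕ) : Type
  | y
  | yInv
  | g (i : Fin m)
  | gInv (i : Fin m)
  | e (i : Fin m)

section Nondegenerate

variable {S : Type*} [CommRing S]

/-- The free generators `y_1`, `y_1⁻¹`, `g_i`, `g_i⁻¹`, `e_i`. -/
def ay {m : ℕ} : FreeAlgebra S (AffGen m) := FreeAlgebra.ι S AffGen.y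

def ayInv {m : ℕ} : FreeAlgebra S (AffGen m) := FreeAlgebra.ι S AffGen.yInv

def ag {m : ℕ} (i : Fin m) : FreeAlgebra S (AffGen m) := FreeAlgebra.ι S (AffGen.g i)

def agInv {m : ℕ} (i : Fin m) : FreeAlgebra S (AffGen m) := FreeAlgebra.ι S (AffGen.gInv i)

def ae {m : ℕ} (i : Fin m) : FreeAlgebra S (AffGen m) := FreeAlgebra.ι S (AffGen.e i)

/-- Defining relations of the affine BMW algebra on `m + 1` strands. -/
inductive AffRel (m : ℕ) (ρ q : Sˣ) (ω : ℕ → S) :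
    FreeAlgebra S (AffGen m) → FreeAlgebra S (AffGen m) → Prop
  | g_gInv (i : Fin m) : AffRel m ρ q ω (ag i * agInv i) 1
  | gInv_g (i : Fin m) : AffRel m ρ q ω (agInv i * ag i) 1
  | y_yInv : AffRel m ρ q ω (ay * ayInv) 1
  | yInv_y : AffRel m ρ q ω (ayInv * ay) 1
  | braid (i j : Fin m) (h : (j : ℕ) = i + 1) :
      AffRel m ρ q ω (ag i * ag j * ag i) (ag j * ag i * ag j)
  | g_g_far (i j : Fin m) (h : Far i j) : AffRel m ρ q ω (ag i * ag j) (ag j * ag i)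
  | braid_y (i : Fin m) (hi : (i : ℕ) = 0) :
      AffRel m ρ q ω (ay * ag i * ay * ag i) (ag i * ay * ag i * ay)
  | y_g (j : Fin m) (hj : (j : ℕ) ≠ 0) : AffRel m ρ q ω (ay * ag j) (ag j * ay)
  | idempotent (i : Fin m) : AffRel m ρ q ω (ae i * ae i) (ω 0 • ae i)
  | compression (i : Fin m) (hi : (i : ℕ) = 0) (j : ℕ) (hj : 1 ≤ j) :
      AffRel m ρ q ω (ae i * ay ^ j * ae i) (ω j • ae i)
  | g_e_far (i j : Fin m) (h : Far i j) : AffRel m ρ q ω (ag i * ae j) (ae j * ag i)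
  | e_e_far (i j : Fin m) (h : Far i j) : AffRel m ρ q ω (ae i * ae j) (ae j * ae i)
  | y_e (j : Fin m) (hj : (j : ℕ) ≠ 0) : AffRel m ρ q ω (ay * ae j) (ae j * ay)
  | g_e (i : Fin m) : AffRel m ρ q ω (ag i * ae i) (((ρ⁻¹ : Sˣ) : S) • ae i)
  | e_g (i : Fin m) : AffRel m ρ q ω (ae i * ag i) (((ρ⁻¹ : Sˣ) : S) • ae i)
  | e_g_e (i j : Fin m) (h : Adjacent i j) :
      AffRel m ρ q ω (ae i * ag j * ae i) ((ρ : S) • ae i)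
  | e_e_e (i j : Fin m) (h : Adjacent i j) : AffRel m ρ q ω (ae i * ae j * ae i) (ae i)
  | g_g_e (i j : Fin m) (h : Adjacent i j) :
      AffRel m ρ q ω (ag i * ag j * ae i) (ae j * ae i)
  | e_g_g (i j : Fin m) (h : Adjacent i j) :
      AffRel m ρ q ω (ae i * ag j * ag i) (ae i * ae j)
  | skein (i : Fin m) :
      AffRel m ρ q ω (ag i - agInv i) (((q : S) - ((q⁻¹ : Sˣ) : S)) • (1 - ae i))
  | unwrap₁ (i : Fin m) (hi : (i : ℕ) = 0) :
      AffRel m ρ q ω (ae i * ay * ag i * ay * ag i) (ae i)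
  | unwrap₂ (i : Fin m) (hi : (i : ℕ) = 0) :
      AffRel m ρ q ω (ag i * ay * ag i * ay * ae i) (ae i)

/-- The affine BMW algebra on `m + 1` strands. -/
abbrev Affine (m : ℕ) (ρ q : Sˣ) (ω : ℕ → S) : Type _ := RingQuot (AffRel m ρ q ω)

/-- The image of a generator in the affine BMW algebra. -/
noncomputable def Affine.gen {m : ℕ} (ρ q : Sˣ) (ω : ℕ → S) (x : AffGen m) : Affine m ρ q ω :=
  RingQuot.mkAlgHom S (AffRel m ρ q ω) (FreeAlgebra.ι S x)

/-- The cyclotomic BMW algebra on `m + 1` strands: the quotient of the affine algebra by the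
relation `(y_1 - u_1) ⋯ (y_1 - u_r) = 0`, the `u_i` being invertible. -/
abbrev Cyclotomic (m : ℕ) (ρ q : Sˣ) (ω : ℕ → S) {r : ℕ} (u : Fin r → Sˣ) : Type _ :=
  RingQuot (PolyRel (rootPoly fun i => (u i : S)) (Affine.gen (m := m) ρ q ω AffGen.y))

/-- The image of a generator in the cyclotomic BMW algebra. -/
noncomputable def Cyclotomic.gen {m : ℕ} (ρ q : Sˣ) (ω : ℕ → S) {r : ℕ} (u : Fin r → Sˣ)
    (x : AffGen m) : Cyclotomic m ρ q ω u :=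
  RingQuot.mkAlgHom S
    (PolyRel (rootPoly fun i => (u i : S)) (Affine.gen (m := m) ρ q ω AffGen.y))
    (Affine.gen ρ q ω x)

/-- The element `y_1` of the cyclotomic BMW algebra on two strands. -/
noncomputable def y₁ (ρ q : Sˣ) (ω : ℕ → S) {r : ℕ} (u : Fin r → Sˣ) : Cyclotomic 1 ρ q ω u :=
  Cyclotomic.gen ρ q ω u AffGen.y

/-- The element `e_1` of the cyclotomic BMW algebra on two strands. -/
noncomputable def e₁ (ρ q : Sˣ) (ω : ℕ → S) {r : ℕ} (u : Fin r → Sˣ) : Cyclotomic 1 ρ q ω u :=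
  Cyclotomic.gen ρ q ω u (AffGen.e 0)

/-- The relation between the ground ring parameters required in the non-degenerate case. -/
def BasicRelation (ρ q : Sˣ) (ω : ℕ → S) : Prop :=
  ((ρ⁻¹ : Sˣ) : S) - (ρ : S) = (((q⁻¹ : Sˣ) : S) - (q : S)) * (ω 0 - 1)

/-- Admissibility of the parameters in the non-degenerate case. -/
def Admissible (ρ q : Sˣ) (ω : ℕ → S) {r : ℕ} (u : Fin r → Sˣ) : Prop :=
  PowersIndependent S (y₁ ρ q ω u) (e₁ ρ q ω u) r

/-- `d`-semi-admissibility of the parameters in the non-degenerate case (for `0 < d < r`). -/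
def SemiAdmissible (ρ q : Sˣ) (ω : ℕ → S) {r : ℕ} (u : Fin r → Sˣ) (d : ℕ) : Prop :=
  PowersIndependent S (y₁ ρ q ω u) (e₁ ρ q ω u) d ∧
    ¬ PowersIndependent S (y₁ ρ q ω u) (e₁ ρ q ω u) (d + 1)

end Nondegenerate

/-- The first `d` of the parameters `u_1, …, u_r`. -/
def firstParams {T : Type*} {d r : ℕ} (h : d ≤ r) (u : Fin r → T) : Fin d → T :=
  fun i => u (Fin.castLE h i)

end BMW

/-!
Let `R` be the affine algebra on two strands, `A` its cyclotomic quotient with parameters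
`u₁, …, u_r`, and `p = p₀`, so that `p(y₁) e = 0` in `A`.

The recursion for `ω` is obtained by evaluating `e y₁ˡ p(y₁) e = 0` with the relations
`e y₁ⁿ e = ωₙ e`, since `e` is torsion free (`sum_coeff_mul_eq_zero`).

For admissibility, an equation `∑ cᵢ y₁ⁱ e = 0` in the quotient of `R` by `p(y₁)` has to be
pulled back to the same equation in `A`. To this end a module over `R` on which `p(y₁)` vanishes
is constructed as `R ⧸ L`, where `L` is the left ideal generated by `p(y₁)`, `p(y₁) s` and the
intersection of the kernels of `χ : R → A` and of `π : R → H`. Here `H` is a matrix algebra, and `π` is a principal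
series representation of the affine Hecke algebra `R ⧸ (e)`. In both cases that Hecke algebra has the
same shape (`IsHecke`): it is spanned by `1` and `s`, which are independent under `π`, over the
polynomials in `y₁` and `y₂`, up to inverting the central element `y₁ y₂` in the nondegenerate case,
where `s` is `g₁` and `y₂` is `g₁ y₁ g₁`.

* The ideal `(e)` of `A` is annihilated by `p(y₁)` from both sides: on the right of `p(y₁)` because
  `A e` consists of the elements `f(y₁) e` (`mul_mul_eq_zero_of_stable`), and on the left of it by
  the anti-automorphism of `A` that fixes the generators (`mul_mul_eq_zero_symm`). Hence
  `p(y₁) R ⊆ L`.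
* The elements of `L` are therefore, modulo elements that vanish in `A` and in `H`, of the form
  `f p + h s p + g p s + k s p s` with `p = p(y₁)` and polynomials `f, g, h, k` in `y₁` and `y₂`. If
  such an element vanishes in `H`, comparing coefficients at `1` and `s` gives two linear equations
  for `h` and `k` modulo `p(y₁)`, whose determinant is monic in `y₂`. So `p(y₁)` divides `h` and `k`,
  and the element lies in `p(y₁) (e)`, which is zero in `A` (`exists_left_ideal`).

Applied to `x = ∑ cᵢ y₁ⁱ e`, which vanishes in `H`, this shows that `x = 0` in the quotient by
`p(y₁)` implies `x = 0` in `A` (`powersIndependent_quotient`).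
-/

namespace BMW

/-! ### Algebras with a rank-two Hecke structure over a polynomial ring in two variables -/

section Hecke

variable {S : Type*} [CommRing S]

/-- The multiplication rules of a rank-two affine Hecke algebra, for an element `s` and the values
`E f` of the polynomials in two commuting variables. The inner variable `C X` of `S[X][X]` stands
for `y₁` and the outer variable `X` for `y₂`. The degenerate Hecke algebra has `z = 0`, `c = -1`;
the nondegenerate one has `z = q - q⁻¹`, `c = 0`. -/
structure IsHecke {Q : Type*} [Ring Q] (E : S[X][X] →+* Q) (s : Q) (z c : S) : Prop where
  mul_const : ∀ r : S, s * E (C (C r)) = E (C (C r)) * s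
  mul_inner : s * E (C X) = E X * s + E (C (C c) - C (C z) * X)
  mul_outer : s * E X = E (C X) * s + E (C (C z) * X - C (C c))
  mul_self : s * s = 1 + E (C (C z)) * s

namespace IsHecke

variable {Q : Type*} [Ring Q] {E : S[X][X] →+* Q} {s : Q} {z c : S}

theorem exists_mul_eq (h : IsHecke E s z c) (f : S[X][X]) :
    ∃ A B : S[X][X], s * E f = E A + E B * s := by
  have hX : ∀ f : S[X][X], (∃ A B : S[X][X], s * E f = E A + E B * s) →
      ∃ A B : S[X][X], s * E (f * X) = E A + E B * s := by
    rintro f ⟨A, B, hf⟩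
    refine ⟨A * X + B * (C (C z) * X - C (C c)), B * C X, ?_⟩
    rw [map_mul, ← mul_assoc, hf, add_mul, mul_assoc (E B), h.mul_outer]
    simp only [map_add, map_mul]
    noncomm_ring
  have hCX : ∀ f : S[X][X], (∃ A B : S[X][X], s * E f = E A + E B * s) →
      ∃ A B : S[X][X], s * E (f * C X) = E A + E B * s := by
    rintro f ⟨A, B, hf⟩
    refine ⟨A * C X + B * (C (C c) - C (C z) * X), B * X, ?_⟩
    rw [map_mul, ← mul_assoc, hf, add_mul, mul_assoc (E B), h.mul_inner]
    simp only [map_add, map_mul]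
    noncomm_ring
  have hadd : ∀ f g : S[X][X], (∃ A B : S[X][X], s * E f = E A + E B * s) →
      (∃ A B : S[X][X], s * E g = E A + E B * s) →
      ∃ A B : S[X][X], s * E (f + g) = E A + E B * s := by
    rintro f g ⟨A, B, hf⟩ ⟨A', B', hg⟩
    refine ⟨A + A', B + B', ?_⟩
    simp only [map_add, mul_add, hf, hg, add_mul]
    abel
  have hC : ∀ a : S[X], ∃ A B : S[X][X], s * E (C a) = E A + E B * s := by
    intro a
    induction a using Polynomial.induction_on with
    | C r => exact ⟨0, C (C r), by simp [h.mul_const]⟩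
    | add p q hp hq => rw [C_add]; exact hadd _ _ hp hq
    | monomial n r ih =>
      rw [pow_succ, ← mul_assoc, C_mul]
      exact hCX _ ih
  induction f using Polynomial.induction_on with
  | C a => exact hC a
  | add p q hp hq => exact hadd _ _ hp hq
  | monomial n a ih =>
    rw [pow_succ, ← mul_assoc]
    exact hX _ ih

/-- Moving `s` past `p(y₁)` gives `p(y₂) (s - z)` up to a term whose degree in `y₂` is less than
that of `p`. (The element `s - z` is the inverse of `s`.) -/
theorem exists_mul_inner_eq (h : IsHecke E s z c) (n : ℕ) (p : S[X]) (hp : p.natDegree ≤ n) :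
    ∃ A : S[X][X], A.natDegree ≤ n - 1 ∧
      s * E (C p) = E A + E (p.map C) * (s - E (C (C z))) := by
  induction n generalizing p with
  | zero =>
    rw [eq_C_of_natDegree_le_zero hp]
    refine ⟨C (C (p.coeff 0 * z)), by rw [natDegree_C], ?_⟩
    rw [h.mul_const, map_C, C_mul, C_mul, map_mul]
    noncomm_ring
  | succ n ih =>
    obtain ⟨A, hA, hpA⟩ := ih p.divX (by rw [natDegree_divX_eq_natDegree_tsub_one]; omega)
    have hs : (s - E (C (C z))) * E (C X) =
        E X * (s - E (C (C z))) + E (C (C c - C z * X)) := by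
      have hX : E X * E (C (C z)) = E (C (C z) * X) := by rw [← map_mul, mul_comm]
      rw [sub_mul, h.mul_inner, mul_sub, hX, C_sub, C_mul]
      simp only [map_sub E, map_mul E]
      abel
    refine ⟨A * C X + p.divX.map C * C (C c - C z * X) + C (C (p.coeff 0 * z)), ?_, ?_⟩
    · refine natDegree_add_le_of_degree_le (natDegree_add_le_of_degree_le ?_ ?_)
        (by rw [natDegree_C]; exact n.zero_le)
      · exact (natDegree_mul_C_le _ _).trans (by omega)
      · refine (natDegree_mul_C_le _ _).trans (natDegree_map_le.trans ?_)
        rw [natDegree_divX_eq_natDegree_tsub_one]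
        omega
    · have e : s * E (C p) = s * E (C p.divX) * E (C X) + s * E (C (C (p.coeff 0))) := by
        conv_lhs => rw [← divX_mul_X_add p]
        rw [C_add, C_mul, map_add, map_mul, mul_add, mul_assoc]
      have e' : p.map C = p.divX.map C * X + C (C (p.coeff 0)) := by
        conv_lhs => rw [← divX_mul_X_add p]
        rw [Polynomial.map_add, Polynomial.map_mul, map_X, map_C]
      rw [e, hpA, h.mul_const, add_mul, mul_assoc (E _), hs, e']
      simp only [map_add, map_mul]
      noncomm_ring

end IsHecke

/-- A polynomial that is monic in `y₂` is not a zero divisor modulo `p(y₁)`. -/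
theorem C_dvd_of_C_dvd_mul_monic {p : S[X]} {h D : S[X][X]} (hD : D.Monic) (hdvd : C p ∣ h * D) :
    C p ∣ h := by
  have key : ∀ g : S[X][X], C p ∣ g ↔ g.map (Ideal.Quotient.mk (Ideal.span {p})) = 0 := by
    intro g
    rw [C_dvd_iff_dvd_coeff, Polynomial.ext_iff]
    simp [Ideal.Quotient.eq_zero_iff_mem, Ideal.mem_span_singleton]
  rw [key] at hdvd ⊢
  rwa [Polynomial.map_mul, (hD.map _).mul_left_eq_zero_iff] at hdvd

/-- With `B = p(y₂)` and `s p(y₁) = (A - z B) + B s`, one has `s p(y₁) s = B + A s`; the polynomial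
here is minus the determinant of the coefficients of these two elements at `1` and `s`. -/
theorem monic_heckeDet {p : S[X]} (hp : p.Monic) {A : S[X][X]} (hA : A.natDegree < p.natDegree)
    (z : S) : (p.map C * p.map C + (C (C z) * p.map C * A - A * A)).Monic := by
  nontriviality S
  have hB : (p.map (C : S →+* S[X])).Monic := hp.map _
  have hBd : (p.map (C : S →+* S[X])).natDegree = p.natDegree := hp.natDegree_map _
  refine (hB.mul hB).add_of_left (degree_lt_degree ?_)
  rw [hB.natDegree_mul hB, hBd]
  refine (natDegree_sub_le _ _).trans_lt (max_lt ?_ ?_)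
  · refine natDegree_mul_le.trans_lt ?_
    have := (natDegree_C_mul_le (C z) (p.map C)).trans_eq hBd
    omega
  · exact natDegree_mul_le.trans_lt (by omega)

/-- There is a left ideal `L` with `p(y₁)` acting as zero on `R ⧸ L`, such that an element of `L`
that vanishes under `π` also vanishes under `χ`.

Here `π` is the map to the Hecke quotient, in which the elements `E f + E g * s` are independent,
and `χ` is a map under which `p(y₁)` annihilates the kernel of `κ` from both sides. Modulo that
kernel, and up to powers of the unit `E ζ`, every element of `R` is of the form `E f + E g * s`. -/
theorem exists_left_ideal {R A H Q : Type*} [Ring R] [Ring A] [Ring H] [Ring Q]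
    (E : S[X][X] →+* R) (s : R) (χ : R →+* A) (π : R →+* H) (κ : R →+* Q) {z c : S}
    (hQ : IsHecke (κ.comp E) (κ s) z c) (ζ : S[X][X]) (hζ : IsUnit (E ζ))
    (p : S[X]) (hp : p.Monic) (hpd : 0 < p.natDegree)
    (hκ : ∀ x, κ x = 0 → π x = 0 ∧ χ (E (C p) * x) = 0 ∧ χ (x * E (C p)) = 0)
    (hπ : ∀ f g, π (E f + E g * s) = 0 → f = 0 ∧ g = 0)
    (hR : ∀ a, ∃ (n : ℕ) (f g : S[X][X]), κ (E ζ ^ n * a) = κ (E f + E g * s)) :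
    ∃ L : Submodule R R, (∀ a, E (C p) * a ∈ L) ∧ ∀ x ∈ L, π x = 0 → χ x = 0 := by
  set P := E (C p) with hP
  have hcomm : ∀ f, P * E f = E f * P := fun f => by rw [hP, ← map_mul, mul_comm, map_mul]
  refine ⟨Submodule.span R {P, P * s} ⊔ (RingHom.ker χ ⊓ RingHom.ker π), ?_, ?_⟩
  · intro a
    obtain ⟨n, f, g, hfg⟩ := hR a
    have hx : κ (E ζ ^ n * a - (E f + E g * s)) = 0 := by rw [map_sub, hfg, sub_self]
    have hmem : E ζ ^ n * (P * a) ∈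
        Submodule.span R {P, P * s} ⊔ (RingHom.ker χ ⊓ RingHom.ker π) := by
      have : E ζ ^ n * (P * a) = (E f * P + E g * (P * s)) +
          P * (E ζ ^ n * a - (E f + E g * s)) := by
        have h1 : E ζ ^ n * P = P * E ζ ^ n := by rw [← map_pow, hcomm]
        rw [← mul_assoc, h1, ← hcomm f, ← mul_assoc (E g), ← hcomm g]
        noncomm_ring
      rw [this]
      refine Submodule.add_mem_sup (Submodule.mem_span_pair.2 ⟨E f, E g, rfl⟩) ⟨?_, ?_⟩
      · exact (hκ _ hx).2.1
      · change π _ = 0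
        rw [map_mul, (hκ _ hx).1, mul_zero]
    obtain ⟨u, hu⟩ := hζ.pow n
    have := Submodule.smul_mem _ (↑u⁻¹ : R) hmem
    rwa [smul_eq_mul, ← hu, Units.inv_mul_cancel_left] at this
  · intro x hx hπx
    obtain ⟨l, hl, w, ⟨hw1, hw2⟩, rfl⟩ := Submodule.mem_sup.1 hx
    replace hw1 : χ w = 0 := hw1
    replace hw2 : π w = 0 := hw2
    obtain ⟨a, b, rfl⟩ := Submodule.mem_span_pair.1 hl
    simp only [smul_eq_mul] at hπx ⊢
    -- A common power of the unit clears both denominators.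
    obtain ⟨n, f, h, g, k, ha, hb⟩ : ∃ (n : ℕ) (f h g k : S[X][X]),
        κ (E ζ ^ n * a - (E f + E h * s)) = 0 ∧ κ (E ζ ^ n * b - (E g + E k * s)) = 0 := by
      obtain ⟨n, f, h, ha⟩ := hR a
      obtain ⟨m, g, k, hb⟩ := hR b
      refine ⟨m + n, ζ ^ m * f, ζ ^ m * h, ζ ^ n * g, ζ ^ n * k, ?_, ?_⟩
      · have : E ζ ^ (m + n) * a - (E (ζ ^ m * f) + E (ζ ^ m * h) * s) =
            E ζ ^ m * (E ζ ^ n * a - (E f + E h * s)) := by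
          simp only [map_mul, map_pow, pow_add]; noncomm_ring
        rw [this, map_mul, map_sub, ha, sub_self, mul_zero]
      · have : E ζ ^ (m + n) * b - (E (ζ ^ n * g) + E (ζ ^ n * k) * s) =
            E ζ ^ n * (E ζ ^ m * b - (E g + E k * s)) := by
          simp only [map_mul, map_pow, add_comm m n, pow_add]; noncomm_ring
        rw [this, map_mul, map_sub, hb, sub_self, mul_zero]
    obtain ⟨A, hAd, hA⟩ := hQ.exists_mul_inner_eq _ p le_rfl
    set B := p.map (C : S →+* S[X]) with hB
    set Z : S[X][X] := C (C z) with hZ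
    -- The errors in the straightening rules for `s * p(y₁)` and `s * s`.
    set k₁ := s * P - (E (A - Z * B) + E B * s) with hk₁
    set k₂ := s * s - (1 + E Z * s) with hk₂
    have hκ₁ : κ k₁ = 0 := by
      simp only [RingHom.comp_apply] at hA
      rw [hk₁, hP]
      simp only [map_sub, map_add, map_mul, hA]
      rw [← map_mul κ (E Z), ← map_mul E, mul_comm Z B, map_mul, map_mul]
      noncomm_ring
    have hκ₂ : κ k₂ = 0 := by
      have := hQ.mul_self
      simp only [RingHom.comp_apply] at this
      rw [hk₂]
      simp only [map_sub, map_add, map_mul, this, map_one, hZ, sub_self]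
    -- The part of `E ζ ^ n * x` that survives under `χ` and `π`.
    set T := E f * P + E h * s * P + E g * (P * s) + E k * s * (P * s) with hT
    have hT' : E ζ ^ n * (a * P + b * (P * s) + w) - T =
        (E ζ ^ n * a - (E f + E h * s)) * P + (E ζ ^ n * b - (E g + E k * s)) * P * s +
          E ζ ^ n * w := by
      rw [hT]; noncomm_ring
    have hχT : χ (E ζ ^ n * (a * P + b * (P * s) + w)) = χ T := by
      rw [← sub_eq_zero, ← map_sub, hT', map_add, map_add, map_mul χ _ s, (hκ _ ha).2.2,
        (hκ _ hb).2.2, map_mul, hw1]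
      simp
    have hπT : π T = 0 := by
      have : π (E ζ ^ n * (a * P + b * (P * s) + w)) = π T := by
        rw [← sub_eq_zero, ← map_sub, hT', map_add, map_add, map_mul π _ P, map_mul π _ s,
          map_mul π _ P, (hκ _ ha).1, (hκ _ hb).1, map_mul, hw2]
        simp
      rw [← this, map_mul, hπx, mul_zero]
    set k₃ := E h * k₁ + E k * k₁ * s + E (k * B) * k₂ with hk₃
    have hT₂ : T = E (f * C p + h * (A - Z * B) + k * B) +
        E (g * C p + h * B + k * (A - Z * B + Z * B)) * s + k₃ := by
      have e1 : s * P = k₁ + (E (A - Z * B) + E B * s) := by rw [hk₁]; abel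
      have e2 : s * s = k₂ + (1 + E Z * s) := by rw [hk₂]; abel
      have e3 : E k * s * (P * s) = E k * k₁ * s + E (k * (A - Z * B)) * s +
          E (k * B) * (s * s) := by
        rw [← mul_assoc, mul_assoc (E k), e1]
        simp only [map_mul]
        noncomm_ring
      have e4 : E (k * B) * (E Z * s) = E (k * (Z * B)) * s := by
        rw [← mul_assoc, ← map_mul]; congr 2; ring
      rw [hT, e3, mul_assoc (E h), e1, e2, ← mul_assoc (E g), mul_add (E (k * B)),
        mul_add (E (k * B)), e4, hk₃, mul_add k]
      simp only [map_add, map_mul E, mul_add, add_mul, mul_one, ← hP]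
      noncomm_ring
    have hπk₃ : π k₃ = 0 := by
      rw [hk₃]
      simp only [map_add, map_mul π, (hκ _ hκ₁).1, (hκ _ hκ₂).1]
      simp
    obtain ⟨h1, h2⟩ := hπ _ _ (by rw [hT₂, map_add, hπk₃, add_zero] at hπT; exact hπT)
    -- Cramer's rule for `h` and `k` modulo `p(y₁)`; the determinant is monic in `y₂`.
    have hD := monic_heckeDet hp (A := A) (by omega) z
    obtain ⟨h', rfl⟩ : C p ∣ h := C_dvd_of_C_dvd_mul_monic hD
      ⟨A * f - B * g, by linear_combination B * h2 - A * h1⟩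
    obtain ⟨k', rfl⟩ : C p ∣ k := C_dvd_of_C_dvd_mul_monic hD
      ⟨(A - Z * B) * g - B * f, by linear_combination B * h1 - (A - Z * B) * h2⟩
    have hχT0 : χ T = 0 := by
      -- Only the error term is left, and it is now a multiple of `p(y₁)`.
      have : T = P * (E h' * k₁ + E k' * k₁ * s + E (k' * B) * k₂) := by
        rw [hT₂, h1, h2, hk₃]
        simp only [map_mul E, map_zero, ← hP]
        noncomm_ring
      rw [this]
      refine (hκ _ ?_).2.1
      simp only [map_add, map_mul κ, hκ₁, hκ₂]
      simp
    rw [hχT0, map_mul, map_pow] at hχT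
    exact (((hζ.map χ).pow n).mul_right_eq_zero).1 hχT

end Hecke

/-! ### Generators, induction and quotients -/

section Generators

variable {S : Type*} [CommRing S]

theorem adjoin_range_mkAlgHom_ι {X : Type*} (r : FreeAlgebra S X → FreeAlgebra S X → Prop) :
    Algebra.adjoin S (Set.range fun x => RingQuot.mkAlgHom S r (FreeAlgebra.ι S x)) = ⊤ := by
  have : (Set.range fun x => RingQuot.mkAlgHom S r (FreeAlgebra.ι S x)) =
      RingQuot.mkAlgHom S r '' Set.range (FreeAlgebra.ι S) := by
    rw [← Set.range_comp]; rfl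
  rw [this, ← AlgHom.map_adjoin, FreeAlgebra.adjoin_range_ι, Algebra.map_top,
    AlgHom.range_eq_top]
  exact RingQuot.mkAlgHom_surjective S r

theorem adjoin_range_comp_mkAlgHom {X R : Type*} [Ring R] [Algebra S R] (r : R → R → Prop)
    {f : X → R} (hf : Algebra.adjoin S (Set.range f) = ⊤) :
    Algebra.adjoin S (Set.range fun x => RingQuot.mkAlgHom S r (f x)) = ⊤ := by
  have : (Set.range fun x => RingQuot.mkAlgHom S r (f x)) =
      RingQuot.mkAlgHom S r '' Set.range f := by
    rw [← Set.range_comp]; rfl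
  rw [this, ← AlgHom.map_adjoin, hf, Algebra.map_top, AlgHom.range_eq_top]
  exact RingQuot.mkAlgHom_surjective S r

theorem self_mem_span_singleton {R : Type*} [Ring R] (e : R) : e ∈ TwoSidedIdeal.span {e} :=
  TwoSidedIdeal.subset_span (Set.mem_singleton e)

theorem smul_induction_of_adjoin_eq_top {R M : Type*} [Ring R] [Algebra S R] [AddCommMonoid M]
    [Module R M] {G : Set R} (hG : Algebra.adjoin S G = ⊤) {P : M → Prop}
    (hadd : ∀ m n, P m → P n → P (m + n)) (hconst : ∀ (r : S) m, P m → P (algebraMap S R r • m))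
    (hgen : ∀ g ∈ G, ∀ m, P m → P (g • m)) (a : R) (m : M) (hm : P m) : P (a • m) := by
  have ha : a ∈ Algebra.adjoin S G := by rw [hG]; trivial
  induction ha using Algebra.adjoin_induction generalizing m with
  | mem x hx => exact hgen x hx m hm
  | algebraMap r => exact hconst r m hm
  | add x y _ _ hx hy => rw [add_smul]; exact hadd _ _ (hx m hm) (hy m hm)
  | mul x y _ _ hx hy => rw [mul_smul]; exact hx _ (hy m hm)

/-- If `p` acts by zero on the module `R ⧸ L`, then that module factors through the quotient of
`R` by the relation `p(y) = 0`. -/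
theorem mem_of_mkAlgHom_polyRel_eq_zero {R : Type*} [Ring R] [Algebra S R] (p : S[X]) (y : R)
    (L : Submodule R R) (hL : ∀ a, aeval y p * a ∈ L) {x : R}
    (hx : RingQuot.mkAlgHom S (PolyRel p y) x = 0) : x ∈ L := by
  have hw : ∀ ⦃a b : R⦄, PolyRel p y a b →
      Module.toAddMonoidEnd R (R ⧸ L) a = Module.toAddMonoidEnd R (R ⧸ L) b := by
    rintro _ _ ⟨⟩
    rw [map_zero]
    ext m
    obtain ⟨a, rfl⟩ := L.mkQ_surjective m
    change aeval y p • L.mkQ a = 0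
    rw [← map_smul, smul_eq_mul]
    exact (Submodule.Quotient.mk_eq_zero L).2 (hL a)
  have h0 : RingQuot.lift ⟨_, hw⟩ (RingQuot.mkRingHom (PolyRel p y) x) = 0 := by
    rw [← RingQuot.mkAlgHom_coe S]
    change RingQuot.lift ⟨_, hw⟩ (RingQuot.mkAlgHom S (PolyRel p y) x) = 0
    rw [hx, map_zero]
  rw [RingQuot.lift_mkRingHom_apply] at h0
  have h1 : x • L.mkQ 1 = 0 := DFunLike.congr_fun h0 (L.mkQ 1)
  rw [← map_smul, smul_eq_mul, mul_one] at h1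
  exact (Submodule.Quotient.mk_eq_zero L).1 h1

theorem aeval_op {A : Type*} [Ring A] [Algebra S A] (y : A) (p : S[X]) :
    aeval (MulOpposite.op y) p = MulOpposite.op (aeval y p) := by
  induction p using Polynomial.induction_on' with
  | add p q hp hq => rw [map_add, map_add, hp, hq, MulOpposite.op_add]
  | monomial n a =>
    rw [aeval_monomial, aeval_monomial, MulOpposite.op_mul, MulOpposite.op_pow,
      (Algebra.commutes a _)]
    rfl

/-- An anti-automorphism fixing the generators carries the vanishing of `p * a * e` over to
`e * a * p`. -/
theorem mul_mul_eq_zero_of_antiHom {A : Type*} [Ring A] [Algebra S A] (τ : A →ₐ[S] Aᵐᵒᵖ)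
    {G : Set A} (hG : Algebra.adjoin S G = ⊤) (hτ : ∀ g ∈ G, τ g = MulOpposite.op g) {p e : A}
    (hp : τ p = MulOpposite.op p) (he : τ e = MulOpposite.op e) (h : ∀ a, p * a * e = 0) (a : A) :
    e * a * p = 0 := by
  have ha : a ∈ Algebra.adjoin S G := by rw [hG]; trivial
  obtain ⟨b, hb⟩ : ∃ b, τ b = MulOpposite.op a := by
    induction ha using Algebra.adjoin_induction with
    | mem x hx => exact ⟨x, hτ x hx⟩
    | algebraMap r => exact ⟨algebraMap S A r, by rw [AlgHom.commutes]; rfl⟩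
    | add x y _ _ hx hy =>
      obtain ⟨b, hb⟩ := hx
      obtain ⟨c, hc⟩ := hy
      exact ⟨b + c, by rw [map_add, hb, hc]; rfl⟩
    | mul x y _ _ hx hy =>
      obtain ⟨b, hb⟩ := hx
      obtain ⟨c, hc⟩ := hy
      exact ⟨c * b, by rw [map_mul, hb, hc]; rfl⟩
  apply MulOpposite.op_injective
  rw [MulOpposite.op_mul, MulOpposite.op_mul, ← hp, ← he, ← hb, ← map_mul, ← map_mul, ← mul_assoc,
    h, map_zero, MulOpposite.op_zero]

/-- The symmetry of `mul_mul_eq_zero_of_antiHom` for a quotient by a relation `p(y) = 0`: it is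
enough that `R` has an anti-homomorphism to the quotient which fixes the generators. -/
theorem mul_mul_eq_zero_symm {R X : Type*} [Ring R] [Algebra S R] {f : X → R}
    (hf : Algebra.adjoin S (Set.range f) = ⊤) (p : S[X]) {y e : R} (i j : X) (hi : f i = y)
    (hj : f j = e) (φ : R →ₐ[S] (RingQuot (PolyRel p y))ᵐᵒᵖ)
    (hφ : ∀ x, φ (f x) = MulOpposite.op (RingQuot.mkAlgHom S (PolyRel p y) (f x))) {q : S[X]}
    (h : ∀ a, aeval (RingQuot.mkAlgHom S (PolyRel p y) y) q * a *
      RingQuot.mkAlgHom S (PolyRel p y) e = 0) (a : RingQuot (PolyRel p y)) :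
    RingQuot.mkAlgHom S (PolyRel p y) e * a *
      aeval (RingQuot.mkAlgHom S (PolyRel p y) y) q = 0 := by
  subst hi hj
  have hw : ∀ ⦃a b : R⦄, PolyRel p (f i) a b → φ a = φ b := by
    rintro _ _ ⟨⟩
    rw [← aeval_algHom_apply, hφ, aeval_op, aeval_algHom_apply,
      RingQuot.mkAlgHom_rel S (PolyRel.rel (p := p) (y := f i)), map_zero, map_zero,
      MulOpposite.op_zero]
  have hτ : ∀ x, RingQuot.liftAlgHom S ⟨φ, hw⟩ (RingQuot.mkAlgHom S (PolyRel p (f i)) (f x)) =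
      MulOpposite.op (RingQuot.mkAlgHom S (PolyRel p (f i)) (f x)) := fun x => by
    rw [RingQuot.liftAlgHom_mkAlgHom_apply, hφ]
  refine mul_mul_eq_zero_of_antiHom (RingQuot.liftAlgHom S ⟨φ, hw⟩)
    (adjoin_range_comp_mkAlgHom _ hf) ?_ ?_ (hτ j) h a
  · rintro _ ⟨x, rfl⟩
    exact hτ x
  · rw [← aeval_algHom_apply, hτ, aeval_op]

theorem monic_rootPoly {k : ℕ} (u : Fin k → S) : (rootPoly u).Monic :=
  monic_prod_of_monic _ _ fun i _ => monic_X_sub_C (u i)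

theorem natDegree_rootPoly [Nontrivial S] {k : ℕ} (u : Fin k → S) : (rootPoly u).natDegree = k := by
  rw [rootPoly, natDegree_prod_of_monic _ _ fun i _ => monic_X_sub_C (u i)]
  simp

end Generators

section TwoVariables

variable {S : Type*} [CommRing S]

/-- Evaluation of a polynomial in two variables at a commuting pair of elements of a possibly
noncommutative algebra: the inner variable goes to `a`, the outer one to `b`. -/
noncomputable def biEval {R : Type*} [Ring R] [Algebra S R] {a b : R} (h : Commute a b) :
    S[X][X] →+* R :=
  eval₂RingHom' (aeval a : S[X] →ₐ[S] R).toRingHom b fun p => by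
    induction p using Polynomial.induction_on' with
    | add p q hp hq => rw [map_add]; exact hp.add_left hq
    | monomial n r =>
      change Commute (aeval a (monomial n r)) b
      rw [aeval_monomial]
      exact (Algebra.commute_algebraMap_left r b).mul_left (h.pow_left n)

variable {R : Type*} [Ring R] [Algebra S R] {a b : R} (h : Commute a b)

@[simp]
theorem biEval_C (p : S[X]) : biEval h (C p) = aeval a p := eval₂_C _ _

@[simp]
theorem biEval_X : biEval h (X : S[X][X]) = b := eval₂_X _ _

theorem map_biEval {B : Type*} [Ring B] [Algebra S B] (φ : R →ₐ[S] B) {a' b' : B}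
    (h' : Commute a' b') (ha : φ a = a') (hb : φ b = b') (f : S[X][X]) :
    φ (biEval h f) = biEval h' f := by
  subst ha hb
  induction f using Polynomial.induction_on' with
  | add p q hp hq => rw [map_add, map_add, hp, hq, map_add]
  | monomial n p =>
    rw [← C_mul_X_pow_eq_monomial]
    simp only [map_mul, map_pow, biEval_C, biEval_X, aeval_algHom_apply]

theorem isHecke_biEval {Q : Type*} [Ring Q] (κ : R →+* Q) {s : R} {z c : S}
    (h₁ : κ (s * a) = κ (b * s + (algebraMap S R c - algebraMap S R z * b)))
    (h₂ : κ (s * b) = κ (a * s + (algebraMap S R z * b - algebraMap S R c)))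
    (h₃ : κ (s * s) = κ (1 + algebraMap S R z * s)) :
    IsHecke (κ.comp (biEval h)) (κ s) z c where
  mul_const r := by
    simp only [RingHom.comp_apply, biEval_C, aeval_C, ← map_mul]
    rw [Algebra.commutes]
  mul_inner := by
    simpa only [RingHom.comp_apply, biEval_C, biEval_X, aeval_C, aeval_X, map_mul, map_add,
      map_sub] using h₁
  mul_outer := by
    simpa only [RingHom.comp_apply, biEval_C, biEval_X, aeval_C, aeval_X, map_mul, map_add,
      map_sub] using h₂
  mul_self := by
    simpa only [RingHom.comp_apply, biEval_C, aeval_C, map_mul, map_add, map_one] using h₃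

end TwoVariables

section Reduced

variable {S R Q : Type*} [CommRing S] [Ring R] [Ring Q] {E : S[X][X] →+* R} {s : R}
  {κ : R →+* Q} {ζ : S[X][X]} {z c : S}

/-- Up to the kernel of `κ` and powers of `E ζ`, the element `a` has the form `E f + E g * s`. -/
def IsReduced (E : S[X][X] →+* R) (s : R) (κ : R →+* Q) (ζ : S[X][X]) (a : R) : Prop :=
  ∃ (n : ℕ) (f g : S[X][X]), κ (E ζ ^ n * a) = κ (E f + E g * s)

namespace IsReduced

theorem one : IsReduced E s κ ζ 1 := ⟨0, 1, 0, by simp⟩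

theorem of_eq_zero {a : R} (ha : κ a = 0) : IsReduced E s κ ζ a := ⟨0, 0, 0, by simp [ha]⟩

theorem add {a b : R} (ha : IsReduced E s κ ζ a) (hb : IsReduced E s κ ζ b) :
    IsReduced E s κ ζ (a + b) := by
  obtain ⟨n, f, g, ha⟩ := ha
  obtain ⟨m, f', g', hb⟩ := hb
  refine ⟨m + n, ζ ^ m * f + ζ ^ n * f', ζ ^ m * g + ζ ^ n * g', ?_⟩
  have e₁ : κ (E ζ ^ (m + n) * a) = κ (E ζ ^ m * (E f + E g * s)) := by
    rw [pow_add, mul_assoc, map_mul, ha, ← map_mul]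
  have e₂ : κ (E ζ ^ (m + n) * b) = κ (E ζ ^ n * (E f' + E g' * s)) := by
    rw [add_comm, pow_add, mul_assoc, map_mul, hb, ← map_mul]
  rw [mul_add, map_add, e₁, e₂, ← map_add]
  congr 1
  simp only [map_add, map_mul, map_pow]
  noncomm_ring

theorem apply_mul {a : R} (f : S[X][X]) (ha : IsReduced E s κ ζ a) :
    IsReduced E s κ ζ (E f * a) := by
  obtain ⟨n, g, g', ha⟩ := ha
  refine ⟨n, f * g, f * g', ?_⟩
  have hc : E ζ ^ n * (E f * a) = E f * (E ζ ^ n * a) := by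
    rw [← map_pow, ← mul_assoc, ← map_mul, mul_comm, map_mul, mul_assoc]
  rw [hc, map_mul κ, ha, ← map_mul]
  congr 1
  simp only [map_mul]
  noncomm_ring

theorem of_apply_mul {a : R} (ha : IsReduced E s κ ζ (E ζ * a)) : IsReduced E s κ ζ a := by
  obtain ⟨n, f, g, ha⟩ := ha
  exact ⟨n + 1, f, g, by rw [pow_succ, mul_assoc, ha]⟩

theorem left_mul {a : R} (hQ : IsHecke (κ.comp E) (κ s) z c) (hζ : Commute (E ζ) s)
    (ha : IsReduced E s κ ζ a) : IsReduced E s κ ζ (s * a) := by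
  obtain ⟨n, f, g, ha⟩ := ha
  obtain ⟨A, B, hf⟩ := hQ.exists_mul_eq f
  obtain ⟨A', B', hg⟩ := hQ.exists_mul_eq g
  have hs := hQ.mul_self
  refine ⟨n, A + B', B + A' + B' * C (C z), ?_⟩
  simp only [RingHom.comp_apply] at hf hg hs
  rw [← mul_assoc, (hζ.pow_left n).eq, mul_assoc, map_mul, ha, map_add, map_mul κ (E g), mul_add,
    ← mul_assoc, hf, hg, add_mul, mul_assoc _ (κ s), hs]
  simp only [map_add, map_mul]
  noncomm_ring

end IsReduced

end Reduced

/-! ### The principal series representation of the Hecke quotient -/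

section Matrices

variable {F : Type*} [CommRing F] (z c a b : F)

/-- The action of `y₁` in the principal series representation, written as a right action on row
vectors with basis `v`, `v * s`, where `v * y₁ = a • v` and `v * y₂ = b • v`. -/
def heckeY : Matrix (Fin 2) (Fin 2) F := !![a, 0; c - z * b, b]

/-- The action of `y₂` in the principal series representation. -/
def heckeY' : Matrix (Fin 2) (Fin 2) F := !![b, 0; z * b - c, a]

/-- The action of `s` in the principal series representation. -/
def heckeS : Matrix (Fin 2) (Fin 2) F := !![0, 1; 1, z]

theorem commute_heckeY : Commute (heckeY z c a b) (heckeY' z c a b) := by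
  rw [Commute, SemiconjBy, heckeY, heckeY', Matrix.mul_fin_two, Matrix.mul_fin_two]
  congr! 2 <;> ring_nf

/-- The vector `v` is an eigenvector of the polynomials in `y₁` and `y₂`. -/
theorem biEval_hecke_row {S : Type*} [CommRing S] [Algebra S F] (f : S[X][X]) :
    biEval (commute_heckeY z c a b) f 0 0 = biEval (Commute.all a b) f ∧
      biEval (commute_heckeY z c a b) f 0 1 = 0 := by
  have hmul : ∀ M N : Matrix (Fin 2) (Fin 2) F, M 0 1 = 0 → N 0 1 = 0 →
      (M * N) 0 0 = M 0 0 * N 0 0 ∧ (M * N) 0 1 = 0 := by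
    intro M N hM hN
    simp [Matrix.mul_apply, Fin.sum_univ_two, hM, hN]
  have hinner : ∀ p : S[X], aeval (heckeY z c a b) p 0 0 = aeval a p ∧
      aeval (heckeY z c a b) p 0 1 = 0 := by
    intro p
    induction p using Polynomial.induction_on with
    | C r => simp [Matrix.algebraMap_matrix_apply]
    | add p q hp hq => simp [hp.1, hp.2, hq.1, hq.2]
    | monomial n r ih =>
      rw [pow_succ, ← mul_assoc, map_mul (aeval (heckeY z c a b)) (C r * X ^ n), aeval_X,
        map_mul (aeval a) (C r * X ^ n), aeval_X, ← ih.1]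
      exact hmul _ _ ih.2 rfl
  induction f using Polynomial.induction_on with
  | C p => simpa using hinner p
  | add p q hp hq => simp [hp.1, hp.2, hq.1, hq.2]
  | monomial n p ih =>
    rw [pow_succ, ← mul_assoc, map_mul (biEval (commute_heckeY z c a b)) (C p * X ^ n), biEval_X,
      map_mul (biEval (Commute.all a b)) (C p * X ^ n), biEval_X, ← ih.1]
    exact hmul _ _ ih.2 rfl

/-- The element `f(y₁, y₂) + g(y₁, y₂) s` sends `v` to `f(a, b) v + g(a, b) v s`. -/
theorem hecke_faithful {S : Type*} [CommRing S] [Algebra S F]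
    (hinj : Function.Injective (biEval (S := S) (Commute.all a b))) {f g : S[X][X]}
    (h : biEval (commute_heckeY z c a b) f + biEval (commute_heckeY z c a b) g * heckeS z = 0) :
    f = 0 ∧ g = 0 := by
  have h0 := congr_fun (congr_fun h 0) 0
  have h1 := congr_fun (congr_fun h 0) 1
  simp [Matrix.mul_apply, Fin.sum_univ_two, biEval_hecke_row, heckeS] at h0 h1
  exact ⟨hinj (by rw [h0, map_zero]), hinj (by rw [h1, map_zero])⟩

theorem biEval_fractionRing_injective (S : Type*) [CommRing S] [IsDomain S] :
    Function.Injective (biEval (S := S) (Commute.all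
      (algebraMap S[X][X] (FractionRing S[X][X]) (C X))
      (algebraMap S[X][X] (FractionRing S[X][X]) X))) := by
  have : (biEval (S := S) (Commute.all
      (algebraMap S[X][X] (FractionRing S[X][X]) (C X))
      (algebraMap S[X][X] (FractionRing S[X][X]) X))) =
      algebraMap S[X][X] (FractionRing S[X][X]) := by
    ext f
    · simp only [RingHom.comp_apply, biEval_C, aeval_C]
      exact IsScalarTower.algebraMap_apply S S[X][X] (FractionRing S[X][X]) f
    · simp
    · simp
  rw [this]
  exact IsFractionRing.injective _ _

end Matrices

/-! ### The left ideal generated by `e` and the comparison theorem -/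

section Comparison

universe v

variable {S : Type*} [CommRing S]

/-- The elements `f(y) e`. -/
noncomputable def powersSpan (S : Type*) {A : Type*} [CommRing S] [Ring A] [Algebra S A]
    (y e : A) : Submodule S A :=
  LinearMap.range ((LinearMap.mulRight S e).comp (aeval y : S[X] →ₐ[S] A).toLinearMap)

theorem mem_powersSpan {A : Type*} [Ring A] [Algebra S A] {y e x : A} :
    x ∈ powersSpan S y e ↔ ∃ f : S[X], aeval y f * e = x := Iff.rfl

variable {A : Type*} [Ring A] [Algebra S A] {y y' s e w : A}

theorem mul_mem_powersSpan_self {x : A} (hx : x ∈ powersSpan S y e) : y * x ∈ powersSpan S y e := by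
  obtain ⟨f, rfl⟩ := mem_powersSpan.1 hx
  exact mem_powersSpan.2 ⟨X * f, by rw [map_mul, aeval_X, mul_assoc]⟩

theorem mul_mem_powersSpan_of_commute {x t : A} (ht : Commute t y) (hte : t * e ∈ powersSpan S y e)
    (hx : x ∈ powersSpan S y e) : t * x ∈ powersSpan S y e := by
  obtain ⟨f, rfl⟩ := mem_powersSpan.1 hx
  obtain ⟨g, hg⟩ := mem_powersSpan.1 hte
  have hf : Commute t (aeval y f) := by
    induction f using Polynomial.induction_on' with
    | add p q hp hq =>
      rw [map_add]
      exact (hp (mem_powersSpan.2 ⟨p, rfl⟩)).add_right (hq (mem_powersSpan.2 ⟨q, rfl⟩))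
    | monomial n r =>
      rw [aeval_monomial]
      exact (Algebra.commute_algebraMap_right r t).mul_right (ht.pow_right n)
  rw [← mul_assoc, hf.eq, mul_assoc, ← hg, ← mul_assoc, ← map_mul]
  exact mem_powersSpan.2 ⟨_, rfl⟩

theorem e_mul_aeval_mul_e {ω : ℕ → S} (h : ∀ n, e * y ^ n * e = ω n • e) (f : S[X]) :
    e * aeval y f * e = (∑ i ∈ Finset.range (f.natDegree + 1), f.coeff i * ω i) • e := by
  rw [aeval_eq_sum_range, Finset.mul_sum, Finset.sum_mul, Finset.sum_smul]
  refine Finset.sum_congr rfl fun i _ => ?_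
  rw [mul_smul_comm, smul_mul_assoc, h, smul_smul]

theorem e_mul_mem_powersSpan {ω : ℕ → S} (h : ∀ n, e * y ^ n * e = ω n • e) {x : A}
    (hx : x ∈ powersSpan S y e) : ∃ r : S, e * x = r • e := by
  obtain ⟨f, rfl⟩ := mem_powersSpan.1 hx
  exact ⟨_, by rw [← mul_assoc, e_mul_aeval_mul_e h]⟩

/-- The elements `f(y) e` are stable under `s` as soon as `s` can be moved past `y`, up to a
multiple of `e`. -/
theorem s_mul_mem_powersSpan {ω : ℕ → S} (h : ∀ n, e * y ^ n * e = ω n • e) {z c r : S}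
    (hyy : Commute y' y) (hy' : y' * e ∈ powersSpan S y e) (hs : s * e = r • e)
    (hw : w * e ∈ powersSpan S y e)
    (hsy : s * y = y' * s + (algebraMap S A c - algebraMap S A z * y') + w * e) {x : A}
    (hx : x ∈ powersSpan S y e) : s * x ∈ powersSpan S y e := by
  obtain ⟨f, rfl⟩ := mem_powersSpan.1 hx
  clear hx
  have he : e ∈ powersSpan S y e := mem_powersSpan.2 ⟨1, by simp⟩
  have hmem : ∀ f : S[X], aeval y f * e ∈ powersSpan S y e := fun f => mem_powersSpan.2 ⟨f, rfl⟩
  induction f using Polynomial.induction_on with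
  | C a =>
    rw [aeval_C, ← mul_assoc, ← Algebra.commutes, mul_assoc, hs, ← Algebra.smul_def]
    exact Submodule.smul_mem _ _ (Submodule.smul_mem _ _ he)
  | add p q hp hq =>
    rw [map_add, add_mul, mul_add]
    exact Submodule.add_mem _ hp hq
  | monomial n a ih =>
    obtain ⟨t, ht⟩ := e_mul_mem_powersSpan h (hmem (C a * X ^ n))
    have : s * (aeval y (C a * X ^ (n + 1)) * e) = y' * (s * (aeval y (C a * X ^ n) * e)) +
        (c • (aeval y (C a * X ^ n) * e) - z • (y' * (aeval y (C a * X ^ n) * e))) +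
        t • (w * e) := by
      rw [pow_succ', mul_left_comm, map_mul, aeval_X, ← mul_assoc, ← mul_assoc, hsy,
        ← mul_smul_comm t w e, ← ht, Algebra.smul_def c, Algebra.smul_def z]
      noncomm_ring
    rw [this]
    refine Submodule.add_mem _ (Submodule.add_mem _ (mul_mem_powersSpan_of_commute hyy hy' ih)
      (Submodule.sub_mem _ (Submodule.smul_mem _ _ (hmem _)) (Submodule.smul_mem _ _
        (mul_mem_powersSpan_of_commute hyy hy' (hmem _))))) (Submodule.smul_mem _ _ hw)

theorem mul_mul_eq_zero_of_stable {G : Set A} (hG : Algebra.adjoin S G = ⊤)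
    (hstab : ∀ g ∈ G, ∀ x ∈ powersSpan S y e, g * x ∈ powersSpan S y e) {p : S[X]}
    (hp : aeval y p * e = 0) (a : A) : aeval y p * a * e = 0 := by
  have : a • e ∈ powersSpan S y e :=
    smul_induction_of_adjoin_eq_top hG (P := fun x => x ∈ powersSpan S y e)
      (fun _ _ => Submodule.add_mem _)
      (fun r m hm => by rw [algebraMap_smul]; exact Submodule.smul_mem _ _ hm) hstab a e
      (mem_powersSpan.2 ⟨1, by simp⟩)
  obtain ⟨f, hf⟩ := mem_powersSpan.1 this
  rw [mul_assoc, ← smul_eq_mul a e, ← hf, ← mul_assoc, ← map_mul, mul_comm, map_mul, mul_assoc, hp,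
    mul_zero]

/-- If `p(y) e = 0` and `p` has degree `d`, multiplication by `e` on both sides of `y ^ l p(y)`
gives a linear recursion for the values `ω_l`, provided `e` is torsion free. -/
theorem sum_coeff_mul_eq_zero {ω : ℕ → S} (h : ∀ n, e * y ^ n * e = ω n • e) {p : S[X]} {d : ℕ}
    (hd : 0 < d) (hpd : p.natDegree = d) (hp : aeval y p * e = 0) (hind : PowersIndependent S y e d)
    (l : ℕ) : ∑ j ∈ Finset.range (d + 1), p.coeff j * ω (j + l) = 0 := by
  have h0 : (∑ j ∈ Finset.range (d + 1), p.coeff j * ω (j + l)) • e = 0 := by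
    have : e * y ^ l * (aeval y p * e) = 0 := by rw [hp, mul_zero]
    rw [← this, aeval_eq_sum_range, hpd, Finset.sum_mul, Finset.mul_sum, Finset.sum_smul]
    refine Finset.sum_congr rfl fun j _ => ?_
    rw [smul_mul_assoc, mul_smul_comm, ← mul_assoc, mul_assoc e, ← pow_add, h, smul_smul,
      add_comm l]
  have := (Fintype.linearIndependent_iff.1 hind)
    (Pi.single ⟨0, hd⟩ (∑ j ∈ Finset.range (d + 1), p.coeff j * ω (j + l)))
    (by
      rw [Finset.sum_eq_single ⟨0, hd⟩ (fun b _ hb => by simp [Pi.single_eq_of_ne hb])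
        (fun hb => absurd (Finset.mem_univ _) hb)]
      simpa using h0) ⟨0, hd⟩
  simpa using this

/-- Independence of the elements `y ^ i e` passes to the quotient of `R` by `p(y)` from any algebra
`A` in which `p(y)` annihilates the ideal generated by `e` from both sides, provided that `R` modulo
`e` has the structure of a rank-two affine Hecke algebra. -/
theorem powersIndependent_quotient {R : Type v} {A H : Type*} [Ring R] [Algebra S R] [Ring A]
    [Algebra S A] [Ring H] [Algebra S H] (χ : R →ₐ[S] A) (π : R →ₐ[S] H) {y y' s e : R}
    (hyy : Commute y y') {z c : S}
    (hsy : s * y - (y' * s + (algebraMap S R c - algebraMap S R z * y')) ∈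
      TwoSidedIdeal.span {e})
    (hsy' : s * y' - (y * s + (algebraMap S R z * y' - algebraMap S R c)) ∈ TwoSidedIdeal.span {e})
    (hss : s * s - (1 + algebraMap S R z * s) ∈ TwoSidedIdeal.span {e}) (ζ : S[X][X])
    (hζ : IsUnit (biEval (S := S) hyy ζ)) {G : Set R} (hG : Algebra.adjoin S G = ⊤)
    (hred : ∀ (Q : Type v) [Ring Q] (κ : R →+* Q), κ e = 0 →
      IsHecke (κ.comp (biEval (S := S) hyy)) (κ s) z c → ∀ g ∈ G, ∀ a,
        IsReduced (biEval (S := S) hyy) s κ ζ a → IsReduced (biEval (S := S) hyy) s κ ζ (g * a))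
    (hπe : π e = 0)
    (hπ : ∀ f g, π (biEval (S := S) hyy f + biEval (S := S) hyy g * s) = 0 → f = 0 ∧ g = 0)
    {p : S[X]} (hp : p.Monic) (hpd : 0 < p.natDegree)
    (hl : ∀ a, χ (aeval y p * a * e) = 0) (hr : ∀ a, χ (e * a * aeval y p) = 0)
    {k : ℕ} (hind : PowersIndependent S (χ y) (χ e) k) :
    PowersIndependent S (RingQuot.mkAlgHom S (PolyRel p y) y)
      (RingQuot.mkAlgHom S (PolyRel p y) e) k := by
  let K : TwoSidedIdeal R := TwoSidedIdeal.span {e}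
  have hker : ∀ x, K.ringCon.mk' x = 0 ↔ x ∈ K := fun x => by
    rw [← TwoSidedIdeal.mem_ker, TwoSidedIdeal.ker_ringCon_mk']
  have hκe : K.ringCon.mk' e = 0 := (hker e).2 (TwoSidedIdeal.subset_span (Set.mem_singleton _))
  have heq : ∀ x x', x - x' ∈ K → K.ringCon.mk' x = K.ringCon.mk' x' := fun x x' h => by
    rw [← sub_eq_zero, ← map_sub, hker]; exact h
  have hQ : IsHecke (K.ringCon.mk'.comp (biEval (S := S) hyy)) (K.ringCon.mk' s) z c :=
    isHecke_biEval hyy _ (heq _ _ hsy) (heq _ _ hsy') (heq _ _ hss)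
  -- The right-hand side is the largest two-sided ideal in the kernel of `π` that `p(y)` annihilates
  -- from both sides under `χ`.
  have hK : K ≤ TwoSidedIdeal.mk'
      {x | π x = 0 ∧ ∀ a, χ (aeval y p * a * x) = 0 ∧ χ (x * a * aeval y p) = 0}
      ⟨map_zero _, by simp⟩
      (fun {x x'} h h' => ⟨by rw [map_add, h.1, h'.1, add_zero], fun a => ⟨by
        rw [mul_add, map_add, (h.2 a).1, (h'.2 a).1, add_zero], by
        rw [add_mul, add_mul, map_add, (h.2 a).2, (h'.2 a).2, add_zero]⟩⟩)
      (fun {x} h => ⟨by rw [map_neg, h.1, neg_zero], fun a => ⟨by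
        rw [mul_neg, map_neg, (h.2 a).1, neg_zero], by
        rw [neg_mul, neg_mul, map_neg, (h.2 a).2, neg_zero]⟩⟩)
      (fun {x x'} h => ⟨by rw [map_mul, h.1, mul_zero], fun a => ⟨by
        rw [← mul_assoc, mul_assoc _ a x, (h.2 (a * x)).1], by
        rw [mul_assoc x, mul_assoc x, map_mul, (h.2 a).2, mul_zero]⟩⟩)
      (fun {x x'} h => ⟨by rw [map_mul, h.1, zero_mul], fun a => ⟨by
        rw [← mul_assoc, map_mul, (h.2 a).1, zero_mul], by
        rw [mul_assoc x, (h.2 (x' * a)).2]⟩⟩) := by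
    refine TwoSidedIdeal.span_le.2 ?_
    rintro _ rfl
    rw [SetLike.mem_coe, TwoSidedIdeal.mem_mk']
    exact ⟨hπe, fun a => ⟨hl a, hr a⟩⟩
  have hκ : ∀ x, K.ringCon.mk' x = 0 → π x = 0 ∧
      χ (biEval hyy (C p) * x) = 0 ∧ χ (x * biEval hyy (C p)) = 0 := by
    intro x hx
    have := hK ((hker x).1 hx)
    rw [TwoSidedIdeal.mem_mk'] at this
    rw [biEval_C]
    refine ⟨this.1, ?_, ?_⟩
    · simpa using (this.2 1).1
    · simpa using (this.2 1).2
  have hR : ∀ a, IsReduced (biEval hyy) s K.ringCon.mk' ζ a := by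
    intro a
    have := smul_induction_of_adjoin_eq_top hG (P := IsReduced (biEval hyy) s K.ringCon.mk' ζ)
      (fun _ _ => IsReduced.add) (fun r m hm => by
        have := hm.apply_mul (C (C r))
        rwa [biEval_C, aeval_C] at this) (hred _ _ hκe hQ) a 1 IsReduced.one
    rwa [smul_eq_mul, mul_one] at this
  obtain ⟨L, hL, hLχ⟩ := exists_left_ideal (biEval (S := S) hyy) s (χ : R →+* A) (π : R →+* H)
    K.ringCon.mk' hQ ζ hζ p hp hpd hκ hπ hR
  rw [biEval_C] at hL
  rw [PowersIndependent, Fintype.linearIndependent_iff] at hind ⊢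
  intro t ht
  refine hind t ?_
  have hx : RingQuot.mkAlgHom S (PolyRel p y) (∑ i, t i • (y ^ (i : ℕ) * e)) = 0 := by
    simpa only [map_sum, map_smul, map_mul, map_pow] using ht
  have hπx : π (∑ i, t i • (y ^ (i : ℕ) * e)) = 0 := by
    simp only [map_sum, map_smul, map_mul, hπe, mul_zero, smul_zero, Finset.sum_const_zero]
  have hχx : χ (∑ i, t i • (y ^ (i : ℕ) * e)) = 0 :=
    hLχ _ (mem_of_mkAlgHom_polyRel_eq_zero p y L hL hx) hπx
  simpa only [map_sum, map_smul, map_mul, map_pow] using hχx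

end Comparison

/-! ### The degenerate algebras on two strands -/

section DegenerateTwoStrands

universe v

variable {S : Type*} [CommRing S]

/-- The defining relations of the degenerate affine BMW algebra on two strands, with `y`, `y'` for
`y₁`, `y₂`. The case `n = 0` of `e_y_e` is the relation for `e * e`. -/
structure IsDegBMW {B : Type*} [Ring B] [Algebra S B] (ω : ℕ → S) (s e y y' : B) : Prop where
  s_s : s * s = 1
  e_y_e : ∀ n, e * y ^ n * e = ω n • e
  y_y : Commute y y'
  e_s : e * s = e
  s_e : s * e = e
  s_y : s * y - y' * s = e - 1
  y_s : y * s - s * y' = e - 1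
  e_add : e * (y + y') = 0
  add_e : (y + y') * e = 0

/-- The map on generators of the degenerate affine BMW algebra on two strands that takes the given
values. -/
def degAssign {B : Type*} (s e y y' : B) : DegGen 1 → B
  | .s _ => s
  | .e _ => e
  | .y j => if j = 0 then y else y'

namespace IsDegBMW

variable {ω : ℕ → S} {B : Type*} [Ring B] [Algebra S B] {s e y y' : B}

theorem map (h : IsDegBMW ω s e y y') {B' : Type*} [Ring B'] [Algebra S B'] (φ : B →ₐ[S] B') :
    IsDegBMW ω (φ s) (φ e) (φ y) (φ y') where
  s_s := by rw [← map_mul, h.s_s, map_one]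
  e_y_e n := by rw [← map_pow, ← map_mul, ← map_mul, h.e_y_e, map_smul]
  y_y := h.y_y.map φ
  e_s := by rw [← map_mul, h.e_s]
  s_e := by rw [← map_mul, h.s_e]
  s_y := by rw [← map_mul, ← map_mul, ← map_sub, h.s_y, map_sub, map_one]
  y_s := by rw [← map_mul, ← map_mul, ← map_sub, h.y_s, map_sub, map_one]
  e_add := by rw [← map_add, ← map_mul, h.e_add, map_zero]
  add_e := by rw [← map_add, ← map_mul, h.add_e, map_zero]

theorem op (h : IsDegBMW ω s e y y') : IsDegBMW ω (MulOpposite.op s) (MulOpposite.op e)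
    (MulOpposite.op y) (MulOpposite.op y') where
  s_s := by rw [← MulOpposite.op_mul, h.s_s, MulOpposite.op_one]
  e_y_e n := by
    rw [← MulOpposite.op_pow, ← MulOpposite.op_mul, ← MulOpposite.op_mul, ← mul_assoc, h.e_y_e,
      MulOpposite.op_smul]
  y_y := h.y_y.op
  e_s := by rw [← MulOpposite.op_mul, h.s_e]
  s_e := by rw [← MulOpposite.op_mul, h.e_s]
  s_y := by
    rw [← MulOpposite.op_mul, ← MulOpposite.op_mul, ← MulOpposite.op_sub, h.y_s]; rfl
  y_s := by
    rw [← MulOpposite.op_mul, ← MulOpposite.op_mul, ← MulOpposite.op_sub, h.s_y]; rfl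
  e_add := by
    rw [← MulOpposite.op_add, ← MulOpposite.op_mul, h.add_e, MulOpposite.op_zero]
  add_e := by
    rw [← MulOpposite.op_add, ← MulOpposite.op_mul, h.e_add, MulOpposite.op_zero]

theorem lift_rel (h : IsDegBMW ω s e y y') {a b : FreeAlgebra S (DegGen 1)}
    (hab : DegRel 1 ω a b) : FreeAlgebra.lift S (degAssign s e y y') a =
      FreeAlgebra.lift S (degAssign s e y y') b := by
  have h0 := h.e_y_e 0
  rw [pow_zero, mul_one] at h0
  have far : ∀ i j : Fin 1, ¬ Far i j := fun i j => by unfold Far; omega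
  have next : ∀ i j : Fin 1, (j : ℕ) ≠ i + 1 := fun i j => by omega
  have other : ∀ (i : Fin 1) (j : Fin 2), j ≠ i.castSucc → j ≠ i.succ → False :=
    fun i j h1 h2 => by
      rw [Ne, Fin.ext_iff, Fin.val_castSucc] at h1
      rw [Ne, Fin.ext_iff, Fin.val_succ] at h2
      omega
  have hz : ∀ i : Fin 1, i.castSucc = 0 := fun i => by
    rw [Fin.ext_iff, Fin.val_castSucc, Fin.val_zero]; omega
  have ho : ∀ i : Fin 1, i.succ ≠ 0 := fun i => Fin.succ_ne_zero i
  cases hab with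
  | involution i => simpa [ds, degAssign] using h.s_s
  | s_s_far i j hf => exact absurd hf (far i j)
  | braid i j hn => exact absurd hn (next i j)
  | s_y i j h1 h2 => exact (other i j h1 h2).elim
  | idempotent i => simpa [de, degAssign] using h0
  | compression i hi a ha => simpa [de, dy, degAssign] using h.e_y_e a
  | s_e_far i j hf => exact absurd hf (far i j)
  | e_e_far i j hf => exact absurd hf (far i j)
  | e_y i j h1 h2 => exact (other i j h1 h2).elim
  | y_y i j =>
    have := h.y_y.eq
    simp only [dy, map_mul, FreeAlgebra.lift_ι_apply, degAssign]
    split_ifs <;> simp [this]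
  | e_s i => simpa [de, ds, degAssign] using h.e_s
  | s_e i => simpa [de, ds, degAssign] using h.s_e
  | tangle₁ i j hn => exact absurd hn (next i j)
  | tangle₂ i j hn => exact absurd hn (next i j)
  | tangle₃ i j hn => exact absurd hn (next i j)
  | tangle₄ i j hn => exact absurd hn (next i j)
  | tangle₅ i j hn => exact absurd hn (next i j)
  | tangle₆ i j hn => exact absurd hn (next i j)
  | skein₁ i => simpa [de, ds, dy, degAssign, hz, ho] using h.s_y
  | skein₂ i => simpa [de, ds, dy, degAssign, hz, ho] using h.y_s
  | antisymm₁ i => simpa [de, ds, dy, degAssign, hz, ho] using h.e_add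
  | antisymm₂ i => simpa [de, ds, dy, degAssign, hz, ho] using h.add_e

theorem exists_lift (h : IsDegBMW ω s e y y') : ∃ φ : DegAffine 1 ω →ₐ[S] B,
    ∀ x, φ (DegAffine.gen ω x) = degAssign s e y y' x :=
  ⟨RingQuot.liftAlgHom S ⟨FreeAlgebra.lift S (degAssign s e y y'), fun _ _ => h.lift_rel⟩,
    fun x => by
      rw [DegAffine.gen, RingQuot.liftAlgHom_mkAlgHom_apply, FreeAlgebra.lift_ι_apply]⟩

theorem mul_mem_powersSpan (h : IsDegBMW ω s e y y') (x : DegGen 1) {v : B}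
    (hv : v ∈ powersSpan S y e) : degAssign s e y y' x * v ∈ powersSpan S y e := by
  have he : e ∈ powersSpan S y e := mem_powersSpan.2 ⟨1, by simp⟩
  have hy' : y' * e ∈ powersSpan S y e := by
    have := h.add_e
    rw [add_mul] at this
    rw [eq_neg_of_add_eq_zero_right this]
    exact Submodule.neg_mem _ (mul_mem_powersSpan_self he)
  cases x with
  | s i =>
    refine s_mul_mem_powersSpan h.e_y_e (z := 0) (c := -1) (r := 1) (w := 1) h.y_y.symm hy'
      (by rw [one_smul]; exact h.s_e) (by rwa [one_mul]) ?_ hv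
    change s * y = _
    rw [eq_add_of_sub_eq h.s_y, map_neg, map_one, map_zero]
    noncomm_ring
  | e i =>
    obtain ⟨r, hr⟩ := e_mul_mem_powersSpan h.e_y_e hv
    change e * v ∈ _
    rw [hr]
    exact Submodule.smul_mem _ _ he
  | y j =>
    change (if j = 0 then y else y') * v ∈ _
    split_ifs
    · exact mul_mem_powersSpan_self hv
    · exact mul_mem_powersSpan_of_commute h.y_y.symm hy' hv

end IsDegBMW

theorem isDegBMW_gen (ω : ℕ → S) : IsDegBMW ω (DegAffine.gen (m := 1) ω (.s 0))
    (DegAffine.gen ω (.e 0)) (DegAffine.gen ω (.y 0)) (DegAffine.gen ω (.y 1)) := by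
  have key : ∀ {a b : FreeAlgebra S (DegGen 1)}, DegRel 1 ω a b →
      RingQuot.mkAlgHom S (DegRel 1 ω) a = RingQuot.mkAlgHom S (DegRel 1 ω) b :=
    fun h => RingQuot.mkAlgHom_rel S h
  constructor
  · simpa [ds, DegAffine.gen] using key (.involution 0)
  · intro n
    rcases Nat.eq_zero_or_pos n with rfl | hn
    · simpa [de, DegAffine.gen] using key (.idempotent 0)
    · simpa [de, dy, DegAffine.gen] using key (.compression 0 rfl n hn)
  · change _ = _
    simpa [dy, DegAffine.gen] using key (.y_y 0 1)
  · simpa [de, ds, DegAffine.gen] using key (.e_s 0)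
  · simpa [de, ds, DegAffine.gen] using key (.s_e 0)
  · simpa [de, ds, dy, DegAffine.gen] using key (.skein₁ 0)
  · simpa [de, ds, dy, DegAffine.gen] using key (.skein₂ 0)
  · simpa [de, ds, dy, DegAffine.gen] using key (.antisymm₁ 0)
  · simpa [de, ds, dy, DegAffine.gen] using key (.antisymm₂ 0)

theorem degAssign_gen (ω : ℕ → S) (x : DegGen 1) : degAssign (DegAffine.gen ω (.s 0))
    (DegAffine.gen ω (.e 0)) (DegAffine.gen ω (.y 0)) (DegAffine.gen ω (.y 1)) x =
      DegAffine.gen ω x := by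
  cases x with
  | s i => rw [Subsingleton.elim i 0]; rfl
  | e i => rw [Subsingleton.elim i 0]; rfl
  | y j => fin_cases j <;> rfl

theorem apply_degAssign {B B' : Type*} (φ : B → B') (s e y y' : B) (x : DegGen 1) :
    degAssign (φ s) (φ e) (φ y) (φ y') x = φ (degAssign s e y y' x) := by
  cases x with
  | s i => rfl
  | e i => rfl
  | y j => exact (apply_ite φ (j = 0) y y').symm

/-- The principal series representation of the degenerate affine Hecke algebra, with `e` acting as
zero. -/
theorem isDegBMW_hecke (ω : ℕ → S) {F : Type*} [CommRing F] [Algebra S F] (a b : F) :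
    IsDegBMW ω (heckeS (0 : F)) 0 (heckeY 0 (-1) a b) (heckeY' 0 (-1) a b) where
  s_s := by
    rw [heckeS, Matrix.mul_fin_two, Matrix.one_fin_two]
    congr! 2 <;> ring_nf
  e_y_e n := by simp
  y_y := commute_heckeY _ _ _ _
  e_s := zero_mul _
  s_e := mul_zero _
  s_y := by
    ext i j
    fin_cases i <;> fin_cases j <;> simp [heckeS, heckeY, heckeY']
  y_s := by
    ext i j
    fin_cases i <;> fin_cases j <;> simp [heckeS, heckeY, heckeY']
  e_add := zero_mul _
  add_e := mul_zero _

theorem IsDegBMW.isReduced_gen_mul {ω : ℕ → S} {R Q : Type*} [Ring R] [Algebra S R] [Ring Q]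
    {s e y y' : R} (h : IsDegBMW ω s e y y') (κ : R →+* Q) (hκ : κ e = 0) {z c : S}
    (hQ : IsHecke (κ.comp (biEval (S := S) h.y_y)) (κ s) z c) (x : DegGen 1) {a : R}
    (ha : IsReduced (biEval (S := S) h.y_y) s κ 1 a) :
    IsReduced (biEval (S := S) h.y_y) s κ 1 (degAssign s e y y' x * a) := by
  cases x with
  | s i => exact ha.left_mul hQ (by rw [map_one]; exact Commute.one_left s)
  | e i => exact IsReduced.of_eq_zero (by rw [map_mul]; exact mul_eq_zero_of_left hκ _)
  | y j =>
    change IsReduced _ s κ 1 ((if j = 0 then y else y') * a)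
    split_ifs
    · have := ha.apply_mul (C X)
      rwa [biEval_C, aeval_X] at this
    · have := ha.apply_mul X
      rwa [biEval_X] at this

/-- The principal series representation factors through the quotient by `e`, and the elements `1`
and `s` act in it independently over the polynomials in `y₁` and `y₂`. -/
theorem exists_degHeckeRep (ω : ℕ → S) {F : Type*} [CommRing F] [Algebra S F] (a b : F)
    (hinj : Function.Injective (biEval (S := S) (Commute.all a b))) :
    ∃ π : DegAffine 1 ω →ₐ[S] Matrix (Fin 2) (Fin 2) F, π (DegAffine.gen ω (.e 0)) = 0 ∧
      ∀ f g, π (biEval (S := S) (isDegBMW_gen ω).y_y f +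
        biEval (S := S) (isDegBMW_gen ω).y_y g * DegAffine.gen ω (.s 0)) = 0 → f = 0 ∧ g = 0 := by
  obtain ⟨π, hπ⟩ := (isDegBMW_hecke ω a b).exists_lift
  refine ⟨π, hπ _, fun f g hfg => hecke_faithful 0 (-1) a b hinj ?_⟩
  rw [map_add, map_mul, map_biEval _ π (commute_heckeY 0 (-1) a b) (hπ _) (hπ _),
    map_biEval _ π (commute_heckeY 0 (-1) a b) (hπ _) (hπ _), hπ] at hfg
  exact hfg

/-- Independence passes from one cyclotomic quotient of `R` to another. The hypotheses on `R` hold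
for the degenerate affine BMW algebra: it is generated by `s`, `e`, `y`, `y'`, it is
universal for its relations, and it maps to the Hecke quotient. -/
theorem IsDegBMW.powersIndependent {ω : ℕ → S} {R : Type v} {H : Type*} [Ring R]
    [Algebra S R] [Ring H] [Algebra S H] {s e y y' : R} (h : IsDegBMW ω s e y y')
    (hG : Algebra.adjoin S (Set.range (degAssign s e y y')) = ⊤) {p q : S[X]} (hp : p.Monic)
    (hpd : 0 < p.natDegree)
    (hlift : ∀ {B : Type v} [Ring B] [Algebra S B] {s₁ e₁ y₁ y₁' : B}, IsDegBMW ω s₁ e₁ y₁ y₁' →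
      ∃ φ : R →ₐ[S] B, ∀ x, φ (degAssign s e y y' x) = degAssign s₁ e₁ y₁ y₁' x)
    (π : R →ₐ[S] H) (hπe : π e = 0)
    (hπ : ∀ f g, π (biEval (S := S) h.y_y f + biEval (S := S) h.y_y g * s) = 0 → f = 0 ∧ g = 0)
    (hpe : aeval (RingQuot.mkAlgHom S (PolyRel q y) y) p * RingQuot.mkAlgHom S (PolyRel q y) e = 0)
    {k : ℕ} (hind : PowersIndependent S (RingQuot.mkAlgHom S (PolyRel q y) y)
      (RingQuot.mkAlgHom S (PolyRel q y) e) k) :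
    PowersIndependent S (RingQuot.mkAlgHom S (PolyRel p y) y)
      (RingQuot.mkAlgHom S (PolyRel p y) e) k := by
  have hA := h.map (RingQuot.mkAlgHom S (PolyRel q y))
  have hl := mul_mul_eq_zero_of_stable (adjoin_range_comp_mkAlgHom (PolyRel q y) hG)
    (by
      rintro _ ⟨x, rfl⟩ w hw
      have := hA.mul_mem_powersSpan x hw
      rwa [apply_degAssign (RingQuot.mkAlgHom S (PolyRel q y))] at this) hpe
  obtain ⟨φ, hφ⟩ := hlift hA.op
  have hr := mul_mul_eq_zero_symm (y := y) (e := e) hG q (.y 0) (.e 0) rfl rfl φ (fun x => by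
    rw [hφ, apply_degAssign MulOpposite.op, apply_degAssign (RingQuot.mkAlgHom S _)]) hl
  have he := self_mem_span_singleton e
  refine powersIndependent_quotient (RingQuot.mkAlgHom S (PolyRel q y)) π h.y_y (z := 0) (c := -1)
    ?_ ?_ ?_ 1 (by rw [map_one]; exact isUnit_one) hG ?_ hπe hπ hp hpd (fun w => ?_) (fun w => ?_)
    hind
  · convert he using 1
    rw [eq_add_of_sub_eq h.s_y, map_neg, map_one, map_zero]
    noncomm_ring
  · convert TwoSidedIdeal.neg_mem _ he using 1
    rw [← sub_sub_self (y * s) (s * y'), h.y_s, map_neg, map_one, map_zero]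
    noncomm_ring
  · rw [h.s_s, map_zero, zero_mul, add_zero, sub_self]
    exact zero_mem _
  · rintro Q _ κ hκ hQ _ ⟨x, rfl⟩ w hw
    exact h.isReduced_gen_mul κ hκ hQ x hw
  · rw [map_mul, map_mul, ← aeval_algHom_apply]
    exact hl _
  · rw [map_mul, map_mul, ← aeval_algHom_apply]
    exact hr _

theorem IsDegBMW.sum_coeff_mul_eq_zero {ω : ℕ → S} {R : Type*} [Ring R] [Algebra S R]
    {s e y y' : R} (h : IsDegBMW ω s e y y') {p q : S[X]} {d : ℕ} (hd : 0 < d)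
    (hpd : p.natDegree = d)
    (hpe : aeval (RingQuot.mkAlgHom S (PolyRel q y) y) p * RingQuot.mkAlgHom S (PolyRel q y) e = 0)
    (hind : PowersIndependent S (RingQuot.mkAlgHom S (PolyRel q y) y)
      (RingQuot.mkAlgHom S (PolyRel q y) e) d) (l : ℕ) :
    ∑ j ∈ Finset.range (d + 1), p.coeff j * ω (j + l) = 0 :=
  BMW.sum_coeff_mul_eq_zero (h.map (RingQuot.mkAlgHom S (PolyRel q y))).e_y_e hd hpd hpe hind l

theorem degAdmissible_of_powersIndependent [IsDomain S] (ω : ℕ → S) {r d : ℕ} (hd : 0 < d)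
    (u : Fin r → S) (v : Fin d → S) (hind : PowersIndependent S (degY₁ ω u) (degE₁ ω u) d)
    (hv : aeval (degY₁ ω u) (rootPoly v) * degE₁ ω u = 0) : DegAdmissible ω v := by
  have h := isDegBMW_gen ω
  obtain ⟨π, hπe, hπ⟩ := exists_degHeckeRep ω _ _ (biEval_fractionRing_injective S)
  have hfun : degAssign (DegAffine.gen ω (.s 0)) (DegAffine.gen ω (.e 0)) (DegAffine.gen ω (.y 0))
      (DegAffine.gen ω (.y 1)) = DegAffine.gen (m := 1) ω := funext (degAssign_gen ω)
  refine h.powersIndependent ?_ (monic_rootPoly v) (by rwa [natDegree_rootPoly]) (fun h' => ?_) π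
    hπe hπ hv hind
  · rw [hfun]
    exact adjoin_range_mkAlgHom_ι _
  · rw [hfun]
    exact h'.exists_lift

end DegenerateTwoStrands

/-! ### The nondegenerate algebras on two strands -/

section NondegenerateTwoStrands

universe v

variable {S : Type*} [CommRing S]

/-- The defining relations of the affine BMW algebra on two strands, where `t` stands for `ρ⁻¹`,
`z` for `q - q⁻¹`, and `yi`, `gi` for the inverses of `y`, `g`. -/
structure IsBMW {B : Type*} [Ring B] [Algebra S B] (t z : S) (ω : ℕ → S) (y yi g gi e : B) :
    Prop where
  g_gi : g * gi = 1
  gi_g : gi * g = 1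
  y_yi : y * yi = 1
  yi_y : yi * y = 1
  braid : y * g * y * g = g * y * g * y
  e_y_e : ∀ n, e * y ^ n * e = ω n • e
  g_e : g * e = t • e
  e_g : e * g = t • e
  skein : g - gi = z • (1 - e)
  unwrap₁ : e * y * g * y * g = e
  unwrap₂ : g * y * g * y * e = e

/-- The map on generators of the affine BMW algebra on two strands that takes the given values. -/
def affAssign {B : Type*} (y yi g gi e : B) : AffGen 1 → B
  | .y => y
  | .yInv => yi
  | .g _ => g
  | .gInv _ => gi
  | .e _ => e

theorem apply_affAssign {B B' : Type*} (φ : B → B') (y yi g gi e : B) (x : AffGen 1) :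
    affAssign (φ y) (φ yi) (φ g) (φ gi) (φ e) x = φ (affAssign y yi g gi e x) := by
  cases x <;> rfl

namespace IsBMW

variable {t z : S} {ω : ℕ → S} {B : Type*} [Ring B] [Algebra S B] {y yi g gi e : B}

theorem map (h : IsBMW t z ω y yi g gi e) {B' : Type*} [Ring B'] [Algebra S B']
    (φ : B →ₐ[S] B') : IsBMW t z ω (φ y) (φ yi) (φ g) (φ gi) (φ e) where
  g_gi := by rw [← map_mul, h.g_gi, map_one]
  gi_g := by rw [← map_mul, h.gi_g, map_one]
  y_yi := by rw [← map_mul, h.y_yi, map_one]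
  yi_y := by rw [← map_mul, h.yi_y, map_one]
  braid := by simp only [← map_mul, h.braid]
  e_y_e n := by rw [← map_pow, ← map_mul, ← map_mul, h.e_y_e, map_smul]
  g_e := by rw [← map_mul, h.g_e, map_smul]
  e_g := by rw [← map_mul, h.e_g, map_smul]
  skein := by rw [← map_sub, h.skein, map_smul, map_sub, map_one]
  unwrap₁ := by simp only [← map_mul, h.unwrap₁]
  unwrap₂ := by simp only [← map_mul, h.unwrap₂]

open MulOpposite in
theorem op (h : IsBMW t z ω y yi g gi e) : IsBMW t z ω (op y) (op yi) (op g) (op gi) (op e) where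
  g_gi := by rw [← op_mul, h.gi_g, op_one]
  gi_g := by rw [← op_mul, h.g_gi, op_one]
  y_yi := by rw [← op_mul, h.yi_y, op_one]
  yi_y := by rw [← op_mul, h.y_yi, op_one]
  braid := by simp only [← op_mul, ← mul_assoc, h.braid]
  e_y_e n := by rw [← op_pow, ← op_mul, ← op_mul, ← mul_assoc, h.e_y_e, op_smul]
  g_e := by rw [← op_mul, h.e_g, op_smul]
  e_g := by rw [← op_mul, h.g_e, op_smul]
  skein := by rw [← op_sub, h.skein, op_smul]; rfl
  unwrap₁ := by simp only [← op_mul, ← mul_assoc, h.unwrap₂]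
  unwrap₂ := by simp only [← op_mul, ← mul_assoc, h.unwrap₁]

theorem y_y (h : IsBMW t z ω y yi g gi e) : Commute y (g * y * g) := by
  change y * (g * y * g) = g * y * g * y
  rw [← h.braid, ← mul_assoc, ← mul_assoc]

theorem gi_eq (h : IsBMW t z ω y yi g gi e) :
    gi = g - algebraMap S B z + algebraMap S B z * e := by
  have := h.skein
  rw [Algebra.smul_def, mul_sub, mul_one] at this
  rw [← sub_sub_self g gi, this]
  abel

/-- The relation `y₁ y₂ e = e`, where `y₂ = g y₁ g`. -/
theorem y'_e (h : IsBMW t z ω y yi g gi e) : g * y * g * e = yi * e := by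
  have h1 : y * (g * y * g * e) = e := by
    have : y * (g * y * g * e) = y * g * y * g * e := by noncomm_ring
    rw [this, h.braid, h.unwrap₂]
  rw [← one_mul (g * y * g * e), ← h.yi_y, mul_assoc yi, h1]

theorem g_y (h : IsBMW t z ω y yi g gi e) : g * y = g * y * g * g +
    (algebraMap S B 0 - algebraMap S B z * (g * y * g)) +
      algebraMap S B z * (g * y * g) * e := by
  have h1 : g * y = g * y * g * gi := by rw [mul_assoc (g * y), h.g_gi, mul_one]
  conv_lhs => rw [h1, h.gi_eq]
  rw [map_zero, mul_add, mul_sub, ← mul_assoc (g * y * g), ← Algebra.commutes z (g * y * g)]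
  abel

theorem g_y' (h : IsBMW t z ω y yi g gi e) : g * (g * y * g) = y * g +
    (algebraMap S B z * (g * y * g) - algebraMap S B 0) -
      algebraMap S B z * (e * (g * y * g)) := by
  have h1 : gi * (g * y * g) = y * g := by
    rw [mul_assoc, ← mul_assoc gi, h.gi_g, one_mul]
  rw [← h1, h.gi_eq, map_zero]
  noncomm_ring

theorem g_g (h : IsBMW t z ω y yi g gi e) : g * g = 1 + algebraMap S B z * g -
    algebraMap S B z * (g * e) := by
  have h1 := h.g_gi
  rw [h.gi_eq, mul_add, mul_sub, ← Algebra.commutes, ← mul_assoc, ← Algebra.commutes,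
    mul_assoc] at h1
  rw [← h1]
  abel

theorem isUnit_y_y' (h : IsBMW t z ω y yi g gi e) : IsUnit (y * (g * y * g)) := by
  have hy : IsUnit y := ⟨⟨y, yi, h.y_yi, h.yi_y⟩, rfl⟩
  have hg : IsUnit g := ⟨⟨g, gi, h.g_gi, h.gi_g⟩, rfl⟩
  exact hy.mul ((hg.mul hy).mul hg)

theorem commute_y_y'_g (h : IsBMW t z ω y yi g gi e) : Commute (y * (g * y * g)) g := by
  change y * (g * y * g) * g = g * (y * (g * y * g))
  have : y * (g * y * g) = y * g * y * g := by noncomm_ring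
  rw [this]
  nth_rewrite 1 [h.braid]
  noncomm_ring

theorem lift_rel {ρ q : Sˣ} (h : IsBMW ((ρ⁻¹ : Sˣ) : S) ((q : S) - ((q⁻¹ : Sˣ) : S)) ω y yi g gi e)
    {a b : FreeAlgebra S (AffGen 1)} (hab : AffRel 1 ρ q ω a b) :
    FreeAlgebra.lift S (affAssign y yi g gi e) a = FreeAlgebra.lift S (affAssign y yi g gi e) b := by
  have h0 := h.e_y_e 0
  rw [pow_zero, mul_one] at h0
  have far : ∀ i j : Fin 1, ¬ Far i j := fun i j => by unfold Far; omega
  have adj : ∀ i j : Fin 1, ¬ Adjacent i j := fun i j => by unfold Adjacent; omega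
  have hz : ∀ i : Fin 1, (i : ℕ) = 0 := fun i => by omega
  cases hab with
  | g_gInv i => simpa [ag, agInv, affAssign] using h.g_gi
  | gInv_g i => simpa [ag, agInv, affAssign] using h.gi_g
  | y_yInv => simpa [ay, ayInv, affAssign] using h.y_yi
  | yInv_y => simpa [ay, ayInv, affAssign] using h.yi_y
  | braid i j hn => omega
  | g_g_far i j hf => exact absurd hf (far i j)
  | braid_y i hi => simpa [ay, ag, affAssign] using h.braid
  | y_g j hj => exact absurd (hz j) hj
  | idempotent i => simpa [ae, affAssign] using h0
  | compression i hi j hj => simpa [ae, ay, affAssign] using h.e_y_e j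
  | g_e_far i j hf => exact absurd hf (far i j)
  | e_e_far i j hf => exact absurd hf (far i j)
  | y_e j hj => exact absurd (hz j) hj
  | g_e i => simpa [ae, ag, affAssign] using h.g_e
  | e_g i => simpa [ae, ag, affAssign] using h.e_g
  | e_g_e i j ha => exact absurd ha (adj i j)
  | e_e_e i j ha => exact absurd ha (adj i j)
  | g_g_e i j ha => exact absurd ha (adj i j)
  | e_g_g i j ha => exact absurd ha (adj i j)
  | skein i =>
    have := h.skein
    simp only [ae, ag, agInv, map_sub, map_smul, map_one, FreeAlgebra.lift_ι_apply]
    exact this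
  | unwrap₁ i hi => simpa [ae, ay, ag, affAssign] using h.unwrap₁
  | unwrap₂ i hi => simpa [ae, ay, ag, affAssign] using h.unwrap₂

theorem exists_lift {ρ q : Sˣ}
    (h : IsBMW ((ρ⁻¹ : Sˣ) : S) ((q : S) - ((q⁻¹ : Sˣ) : S)) ω y yi g gi e) :
    ∃ φ : Affine 1 ρ q ω →ₐ[S] B, ∀ x, φ (Affine.gen ρ q ω x) = affAssign y yi g gi e x :=
  ⟨RingQuot.liftAlgHom S ⟨FreeAlgebra.lift S (affAssign y yi g gi e), fun _ _ => h.lift_rel⟩,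
    fun x => by
      rw [Affine.gen, RingQuot.liftAlgHom_mkAlgHom_apply, FreeAlgebra.lift_ι_apply]⟩

/-- If `p(y) e = 0` and `p` has invertible constant term, `y⁻¹ e` is a polynomial in `y` times
`e`. -/
theorem yi_e_mem_powersSpan (h : IsBMW t z ω y yi g gi e) {p : S[X]} (hp : IsUnit (p.coeff 0))
    (hpe : aeval y p * e = 0) : yi * e ∈ powersSpan S y e := by
  obtain ⟨r, hr⟩ := hp
  have h1 : yi * (aeval y p * e) = aeval y p.divX * e + (r : S) • (yi * e) := by
    conv_lhs => rw [← X_mul_divX_add p]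
    rw [map_add, map_mul, aeval_X, aeval_C, ← hr, add_mul, mul_add, mul_assoc y, ← mul_assoc yi,
      h.yi_y, one_mul, ← Algebra.smul_def, mul_smul_comm]
  rw [hpe, mul_zero] at h1
  have h2 : (r : S) • (yi * e) ∈ powersSpan S y e := by
    rw [eq_neg_of_add_eq_zero_right h1.symm]
    exact Submodule.neg_mem _ (mem_powersSpan.2 ⟨_, rfl⟩)
  have h3 := Submodule.smul_mem _ ((r⁻¹ : Sˣ) : S) h2
  rwa [smul_smul, Units.inv_mul, one_smul] at h3

theorem mul_mem_powersSpan (h : IsBMW t z ω y yi g gi e) (hyi : yi * e ∈ powersSpan S y e)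
    (x : AffGen 1) {v : B} (hv : v ∈ powersSpan S y e) :
    affAssign y yi g gi e x * v ∈ powersSpan S y e := by
  have he : e ∈ powersSpan S y e := mem_powersSpan.2 ⟨1, by simp⟩
  have hy' : g * y * g * e ∈ powersSpan S y e := by rwa [h.y'_e]
  have hg : g * v ∈ powersSpan S y e := by
    refine s_mul_mem_powersSpan h.e_y_e h.y_y.symm hy' h.g_e
      (w := algebraMap S B z * (g * y * g)) ?_ h.g_y hv
    rw [mul_assoc, ← Algebra.smul_def]
    exact Submodule.smul_mem _ _ hy'
  obtain ⟨r, hr⟩ := e_mul_mem_powersSpan h.e_y_e hv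
  cases x with
  | y => exact mul_mem_powersSpan_self hv
  | yInv =>
    exact mul_mem_powersSpan_of_commute (h.yi_y.trans h.y_yi.symm) hyi hv
  | g i => exact hg
  | gInv i =>
    change gi * v ∈ _
    rw [h.gi_eq, add_mul, sub_mul, mul_assoc, hr, ← Algebra.smul_def, ← Algebra.smul_def]
    exact Submodule.add_mem _ (Submodule.sub_mem _ hg (Submodule.smul_mem _ _ hv))
      (Submodule.smul_mem _ _ (Submodule.smul_mem _ _ he))
  | e i =>
    change e * v ∈ _
    rw [hr]
    exact Submodule.smul_mem _ _ he

theorem isReduced_gen_mul {Q : Type*} [Ring Q] (h : IsBMW t z ω y yi g gi e) (κ : B →+* Q)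
    (hκ : κ e = 0) {c : S} (hQ : IsHecke (κ.comp (biEval (S := S) h.y_y)) (κ g) z c)
    (x : AffGen 1) {a : B} (ha : IsReduced (biEval (S := S) h.y_y) g κ (C X * X) a) :
    IsReduced (biEval (S := S) h.y_y) g κ (C X * X) (affAssign y yi g gi e x * a) := by
  have hζ : biEval (S := S) h.y_y (C X * X) = y * (g * y * g) := by
    rw [map_mul, biEval_C, biEval_X, aeval_X]
  have hg := ha.left_mul hQ (by rw [hζ]; exact h.commute_y_y'_g)
  cases x with
  | y =>
    have := ha.apply_mul (C X)
    rwa [biEval_C, aeval_X] at this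
  | yInv =>
    -- The denominator `y₁ y₂` absorbs the inverse: `y₁ y₂ y₁⁻¹ = y₂`.
    refine IsReduced.of_apply_mul ?_
    have := ha.apply_mul X
    have e1 : biEval (S := S) h.y_y (C X * X) * (yi * a) = biEval (S := S) h.y_y X * a := by
      rw [hζ, h.y_y.eq, biEval_X, mul_assoc, ← mul_assoc y, h.y_yi, one_mul]
    change IsReduced _ g κ _ (_ * (yi * a))
    rwa [e1]
  | g i => exact hg
  | gInv i =>
    have h1 := ha.apply_mul (C (C (-z)))
    have h2 : IsReduced (biEval (S := S) h.y_y) g κ (C X * X) (algebraMap S B z * e * a) :=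
      IsReduced.of_eq_zero (by rw [map_mul, map_mul, hκ, mul_zero, zero_mul])
    have := (hg.add h1).add h2
    change IsReduced _ g κ _ (gi * a)
    convert this using 1
    rw [biEval_C, aeval_C, h.gi_eq, map_neg]
    noncomm_ring
  | e i => exact IsReduced.of_eq_zero (by rw [map_mul]; exact mul_eq_zero_of_left hκ _)

/-- Independence passes from one cyclotomic quotient of `R` to another. The hypotheses on `R` hold
for the affine BMW algebra: it is generated by `y`, `y⁻¹`, `g`, `g⁻¹`, `e`, it is universal for its
relations, and it maps to the Hecke quotient. -/
theorem powersIndependent {R : Type v} {H : Type*} [Ring R] [Algebra S R] [Ring H] [Algebra S H]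
    {y yi g gi e : R} (h : IsBMW t z ω y yi g gi e)
    (hG : Algebra.adjoin S (Set.range (affAssign y yi g gi e)) = ⊤) {p q : S[X]} (hp : p.Monic)
    (hpd : 0 < p.natDegree) (hp0 : IsUnit (p.coeff 0))
    (hlift : ∀ {B : Type v} [Ring B] [Algebra S B] {y₁ yi₁ g₁ gi₁ e₁ : B},
      IsBMW t z ω y₁ yi₁ g₁ gi₁ e₁ →
        ∃ φ : R →ₐ[S] B, ∀ x, φ (affAssign y yi g gi e x) = affAssign y₁ yi₁ g₁ gi₁ e₁ x)
    (π : R →ₐ[S] H) (hπe : π e = 0)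
    (hπ : ∀ f k, π (biEval (S := S) h.y_y f + biEval (S := S) h.y_y k * g) = 0 → f = 0 ∧ k = 0)
    (hpe : aeval (RingQuot.mkAlgHom S (PolyRel q y) y) p * RingQuot.mkAlgHom S (PolyRel q y) e = 0)
    {k : ℕ} (hind : PowersIndependent S (RingQuot.mkAlgHom S (PolyRel q y) y)
      (RingQuot.mkAlgHom S (PolyRel q y) e) k) :
    PowersIndependent S (RingQuot.mkAlgHom S (PolyRel p y) y)
      (RingQuot.mkAlgHom S (PolyRel p y) e) k := by
  have hA := h.map (RingQuot.mkAlgHom S (PolyRel q y))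
  have hl := mul_mul_eq_zero_of_stable (adjoin_range_comp_mkAlgHom (PolyRel q y) hG)
    (by
      rintro _ ⟨x, rfl⟩ w hw
      have := hA.mul_mem_powersSpan (hA.yi_e_mem_powersSpan hp0 hpe) x hw
      rwa [apply_affAssign (RingQuot.mkAlgHom S (PolyRel q y))] at this) hpe
  obtain ⟨φ, hφ⟩ := hlift hA.op
  have hr := mul_mul_eq_zero_symm (y := y) (e := e) hG q .y (.e 0) rfl rfl φ (fun x => by
    rw [hφ, apply_affAssign MulOpposite.op, apply_affAssign (RingQuot.mkAlgHom S _)]) hl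
  have he := self_mem_span_singleton e
  refine powersIndependent_quotient (RingQuot.mkAlgHom S (PolyRel q y)) π h.y_y (z := z) (c := 0)
    ?_ ?_ ?_ (C X * X) ?_ hG ?_ hπe hπ hp hpd (fun w => ?_) (fun w => ?_) hind
  · have := TwoSidedIdeal.mul_mem_left _ (algebraMap S R z * (g * y * g)) _ he
    convert this using 1
    nth_rewrite 1 [h.g_y]
    abel
  · have := TwoSidedIdeal.neg_mem _ (TwoSidedIdeal.mul_mem_left _ (algebraMap S R z) _
      (TwoSidedIdeal.mul_mem_right _ _ (g * y * g) he))
    convert this using 1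
    rw [h.g_y']
    abel
  · have := TwoSidedIdeal.neg_mem _ (TwoSidedIdeal.mul_mem_left _ (algebraMap S R z) _
      (TwoSidedIdeal.mul_mem_left _ g _ he))
    convert this using 1
    rw [h.g_g]
    abel
  · rw [map_mul, biEval_C, biEval_X, aeval_X]
    exact h.isUnit_y_y'
  · rintro Q _ κ hκ hQ _ ⟨x, rfl⟩ w hw
    exact h.isReduced_gen_mul κ hκ hQ x hw
  · rw [map_mul, map_mul, ← aeval_algHom_apply]
    exact hl _
  · rw [map_mul, map_mul, ← aeval_algHom_apply]
    exact hr _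

end IsBMW

theorem isBMW_gen (ρ q : Sˣ) (ω : ℕ → S) :
    IsBMW ((ρ⁻¹ : Sˣ) : S) ((q : S) - ((q⁻¹ : Sˣ) : S)) ω (Affine.gen (m := 1) ρ q ω .y)
      (Affine.gen ρ q ω .yInv) (Affine.gen ρ q ω (.g 0)) (Affine.gen ρ q ω (.gInv 0))
      (Affine.gen ρ q ω (.e 0)) := by
  have key : ∀ {a b : FreeAlgebra S (AffGen 1)}, AffRel 1 ρ q ω a b →
      RingQuot.mkAlgHom S (AffRel 1 ρ q ω) a = RingQuot.mkAlgHom S (AffRel 1 ρ q ω) b :=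
    fun h => RingQuot.mkAlgHom_rel S h
  constructor
  · simpa [ag, agInv, Affine.gen] using key (.g_gInv 0)
  · simpa [ag, agInv, Affine.gen] using key (.gInv_g 0)
  · simpa [ay, ayInv, Affine.gen] using key .y_yInv
  · simpa [ay, ayInv, Affine.gen] using key .yInv_y
  · simpa [ay, ag, Affine.gen] using key (.braid_y 0 rfl)
  · intro n
    rcases Nat.eq_zero_or_pos n with rfl | hn
    · simpa [ae, Affine.gen] using key (.idempotent 0)
    · simpa [ae, ay, Affine.gen] using key (.compression 0 rfl n hn)
  · simpa [ag, ae, Affine.gen] using key (.g_e 0)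
  · simpa [ag, ae, Affine.gen] using key (.e_g 0)
  · have := key (.skein 0)
    simp only [ae, ag, agInv, map_sub, map_smul, map_one] at this
    exact this
  · simpa [ay, ag, ae, Affine.gen] using key (.unwrap₁ 0 rfl)
  · simpa [ay, ag, ae, Affine.gen] using key (.unwrap₂ 0 rfl)

theorem affAssign_gen (ρ q : Sˣ) (ω : ℕ → S) (x : AffGen 1) :
    affAssign (Affine.gen ρ q ω .y) (Affine.gen ρ q ω .yInv) (Affine.gen ρ q ω (.g 0))
      (Affine.gen ρ q ω (.gInv 0)) (Affine.gen ρ q ω (.e 0)) x = Affine.gen ρ q ω x := by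
  cases x with
  | y => rfl
  | yInv => rfl
  | g i => rw [Subsingleton.elim i 0]; rfl
  | gInv i => rw [Subsingleton.elim i 0]; rfl
  | e i => rw [Subsingleton.elim i 0]; rfl

theorem heckeS_mul_heckeY_mul_heckeS {F : Type*} [CommRing F] (z a b : F) :
    heckeS z * heckeY z 0 a b * heckeS z = heckeY' z 0 a b := by
  rw [heckeS, heckeY, heckeY', Matrix.mul_fin_two, Matrix.mul_fin_two]
  congr! 2 <;> ring_nf

/-- The principal series representation of the affine Hecke algebra, with `e` acting as zero. -/
theorem isBMW_hecke (t z : S) (ω : ℕ → S) {F : Type*} [Field F] [Algebra S F] {a b : F}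
    (ha : a ≠ 0) (hb : b ≠ 0) :
    IsBMW t z ω (heckeY (algebraMap S F z) 0 a b) !![a⁻¹, 0; algebraMap S F z * a⁻¹, b⁻¹]
      (heckeS (algebraMap S F z)) !![-algebraMap S F z, 1; 1, 0] 0 where
  g_gi := by
    rw [heckeS, Matrix.mul_fin_two, Matrix.one_fin_two]
    congr! 2 <;> ring_nf
  gi_g := by
    rw [heckeS, Matrix.mul_fin_two, Matrix.one_fin_two]
    congr! 2 <;> ring_nf
  y_yi := by
    ext i j
    fin_cases i <;> fin_cases j <;> simp [heckeY, ha, hb]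
    ring
  yi_y := by
    ext i j
    fin_cases i <;> fin_cases j <;> simp [heckeY, ha, hb]
    field_simp
    ring
  braid := by
    have := (commute_heckeY (algebraMap S F z) 0 a b).eq
    rw [← heckeS_mul_heckeY_mul_heckeS] at this
    simpa only [mul_assoc] using this
  e_y_e n := by simp
  g_e := by simp
  e_g := by simp
  skein := by
    ext i j
    fin_cases i <;> fin_cases j <;> simp [heckeS, Algebra.smul_def]
  unwrap₁ := by simp
  unwrap₂ := by simp

/-- The principal series representation factors through the quotient by `e`, and the elements `1`
and `g` act in it independently over the polynomials in `y₁` and `y₂`. -/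
theorem exists_heckeRep (ρ q : Sˣ) (ω : ℕ → S) {F : Type*} [Field F] [Algebra S F] {a b : F}
    (ha : a ≠ 0) (hb : b ≠ 0) (hinj : Function.Injective (biEval (S := S) (Commute.all a b))) :
    ∃ π : Affine 1 ρ q ω →ₐ[S] Matrix (Fin 2) (Fin 2) F, π (Affine.gen ρ q ω (.e 0)) = 0 ∧
      ∀ f k, π (biEval (S := S) (isBMW_gen ρ q ω).y_y f +
        biEval (S := S) (isBMW_gen ρ q ω).y_y k * Affine.gen ρ q ω (.g 0)) = 0 →
          f = 0 ∧ k = 0 := by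
  obtain ⟨π, hπ⟩ := (isBMW_hecke ((ρ⁻¹ : Sˣ) : S) ((q : S) - ((q⁻¹ : Sˣ) : S)) ω ha hb).exists_lift
  have hy' : π (Affine.gen ρ q ω (.g 0) * Affine.gen ρ q ω .y * Affine.gen ρ q ω (.g 0)) =
      heckeY' (algebraMap S F ((q : S) - ((q⁻¹ : Sˣ) : S))) 0 a b := by
    rw [map_mul, map_mul, hπ, hπ]
    exact heckeS_mul_heckeY_mul_heckeS _ a b
  refine ⟨π, hπ _, fun f k hfk =>
    hecke_faithful (algebraMap S F ((q : S) - ((q⁻¹ : Sˣ) : S))) 0 a b hinj ?_⟩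
  rw [map_add, map_mul, map_biEval _ π (commute_heckeY _ 0 a b) (hπ _) hy',
    map_biEval _ π (commute_heckeY _ 0 a b) (hπ _) hy', hπ] at hfk
  exact hfk

theorem isUnit_coeff_zero_rootPoly {k : ℕ} (u : Fin k → Sˣ) :
    IsUnit ((rootPoly fun i => (u i : S)).coeff 0) := by
  rw [coeff_zero_eq_eval_zero, rootPoly, eval_prod]
  simp only [eval_sub, eval_X, eval_C, zero_sub]
  exact Finset.prod_induction _ IsUnit (fun _ _ => IsUnit.mul) isUnit_one
    fun i _ => (u i).isUnit.neg

theorem IsBMW.sum_coeff_mul_eq_zero {t z : S} {ω : ℕ → S} {R : Type*} [Ring R] [Algebra S R]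
    {y yi g gi e : R} (h : IsBMW t z ω y yi g gi e) {p q : S[X]} {d : ℕ} (hd : 0 < d)
    (hpd : p.natDegree = d)
    (hpe : aeval (RingQuot.mkAlgHom S (PolyRel q y) y) p * RingQuot.mkAlgHom S (PolyRel q y) e = 0)
    (hind : PowersIndependent S (RingQuot.mkAlgHom S (PolyRel q y) y)
      (RingQuot.mkAlgHom S (PolyRel q y) e) d) (l : ℕ) :
    ∑ j ∈ Finset.range (d + 1), p.coeff j * ω (j + l) = 0 :=
  BMW.sum_coeff_mul_eq_zero (h.map (RingQuot.mkAlgHom S (PolyRel q y))).e_y_e hd hpd hpe hind l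

theorem admissible_of_powersIndependent [IsDomain S] (ρ q : Sˣ) (ω : ℕ → S) {r d : ℕ} (hd : 0 < d)
    (u : Fin r → Sˣ) (v : Fin d → Sˣ) (hind : PowersIndependent S (y₁ ρ q ω u) (e₁ ρ q ω u) d)
    (hv : aeval (y₁ ρ q ω u) (rootPoly fun i => (v i : S)) * e₁ ρ q ω u = 0) :
    Admissible ρ q ω v := by
  have h := isBMW_gen ρ q ω
  have hinj := IsFractionRing.injective S[X][X] (FractionRing S[X][X])
  obtain ⟨π, hπe, hπ⟩ := exists_heckeRep ρ q ω
    ((map_ne_zero_iff _ hinj).2 (C_ne_zero.2 X_ne_zero)) ((map_ne_zero_iff _ hinj).2 X_ne_zero)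
    (biEval_fractionRing_injective S)
  have hfun : affAssign (Affine.gen ρ q ω .y) (Affine.gen ρ q ω .yInv) (Affine.gen ρ q ω (.g 0))
      (Affine.gen ρ q ω (.gInv 0)) (Affine.gen ρ q ω (.e 0)) = Affine.gen (m := 1) ρ q ω :=
    funext (affAssign_gen ρ q ω)
  refine h.powersIndependent ?_ (monic_rootPoly _) (by rwa [natDegree_rootPoly])
    (isUnit_coeff_zero_rootPoly v) (fun h' => ?_) π hπe hπ hv hind
  · rw [hfun]
    exact adjoin_range_mkAlgHom_ι _
  · rw [hfun]
    exact h'.exists_lift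

end NondegenerateTwoStrands

end BMW

theorem mainTheorem9 {S : Type*} [CommRing S] [IsDomain S] (r d : ℕ) (hd : 0 < d) (hdr : d < r)
    (ω : ℕ → S) :
    (∀ u : Fin r → S,
      BMW.DegSemiAdmissible ω u d →
      aeval (BMW.degY₁ ω u) (BMW.rootPoly (BMW.firstParams hdr.le u)) * BMW.degE₁ ω u = 0 →
        (∀ l : ℕ, ∑ j ∈ Finset.range (d + 1),
          (BMW.rootPoly (BMW.firstParams hdr.le u)).coeff j * ω (j + l) = 0) ∧
        BMW.DegAdmissible ω (BMW.firstParams hdr.le u)) ∧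
    (∀ (ρ q : Sˣ) (u : Fin r → Sˣ),
      BMW.BasicRelation ρ q ω →
      BMW.SemiAdmissible ρ q ω u d →
      aeval (BMW.y₁ ρ q ω u) (BMW.rootPoly fun i => ((BMW.firstParams hdr.le u i : Sˣ) : S)) *
        BMW.e₁ ρ q ω u = 0 →
        (∀ l : ℕ, ∑ j ∈ Finset.range (d + 1),
          (BMW.rootPoly fun i => ((BMW.firstParams hdr.le u i : Sˣ) : S)).coeff j * ω (j + l) = 0) ∧
        BMW.Admissible ρ q ω (BMW.firstParams hdr.le u)) := by
  refine ⟨fun u hu hp => ⟨?_, ?_⟩, fun ρ q u _ hu hp => ⟨?_, ?_⟩⟩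
  · exact (BMW.isDegBMW_gen ω).sum_coeff_mul_eq_zero hd (BMW.natDegree_rootPoly _) hp hu.1
  · exact BMW.degAdmissible_of_powersIndependent ω hd u _ hu.1 hp
  · exact (BMW.isBMW_gen ρ q ω).sum_coeff_mul_eq_zero hd (BMW.natDegree_rootPoly _) hp hu.1
  · exact BMW.admissible_of_powersIndependent ρ q ω hd u _ hu.1 hp
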